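/- Let $k$ be a field with algebraic closure $\bar k$, let $X$ and $Y$ be normal, proper, geometrically integral $k$-varieties, and let $g\colon X\dashrightarrow Y$ be a birational map over $k$. Let $|D|$ be a (not necessarily complete) linear system of Weil divisors on $X$ without fixed components; that is, $|D|$ is the projective space of lines in a nonzero finite dimensional $k$-subspace $V\subset H^0(X,\mathcal O_X(D))\subset k(X)$, where $[f]$ corresponds to the effective divisor $D+(f)$, and no prime divisor of $X$ is contained in all members. For a geometric point $\lambda\in|D|(\bar k)$ let $D_\lambda$ denote the corresponding member, a Weil divisor on $X_{\bar k}$, and let $g_*(D_\lambda)$ denote its birational transform on $Y_{\bar k}$ (the closures of the images of the prime divisors not contracted by $g$, with the same multiplicities). Let $g_*|D|$ be the birational transform of $|D|$: the linear system on $Y$ without fixed components, parametrized by the same projective space, whose incidence correspondence in $Y\times|D|$ is the closure of the image of the incidence correspondence of $|D|$ in $X\times |D|$. Let $W\subset|D|$ be a geometrically irreducible (locally closed) $k$-subvariety that spans $|D|$, that is, $W(\bar k)$ is not contained in any hyperplane of $|D|_{\bar k}$. Then there is a dense, open $k$-subvariety $W^\circ\subset W$ such that the divisors $g_*(D_\lambda)$,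 $\lambda\in W^\circ(\bar k)$, are pairwise linearly equivalent on $Y_{\bar k}$, and the linear system spanned by them is the birational transform of $|D|$: $$ (g_*|D|)_{\bar k}=\bigl|\,g_*(D_\lambda):\lambda\in W^\circ(\bar k)\,\bigr| . $$ -/

import Mathlib

open AlgebraicGeometry CategoryTheory Limits Order
open scoped LinearAlgebra.Projectivization

universe u

noncomputable section

namespace WeilLinearSystem

/-! ## Function fields, normality, constants -/

/-- A scheme is normal if all its local rings are integrally closed domains
(used here for integral schemes only). -/
class IsNormalScheme (X : Scheme.{u}) : Prop where
  isIntegrallyClosed_stalk : ∀ x : X, IsIntegrallyClosed (X.presheaf.stalk x)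

theorem map_genericPoint {Z X : Scheme.{u}} [IsIntegral Z] [IsIntegral X] (f : Z ⟶ X)
    [IsDominant f] : f (genericPoint Z) = genericPoint X := by
  apply ((genericPoint_spec X).eq _).symm
  have h := (genericPoint_spec Z).image f.continuous
  rw [Set.image_univ, f.denseRange.closure_range] at h
  exact h

/-- The homomorphism `K(X) → K(Z)` of function fields (pull-back of rational functions) induced by
a dominant morphism `f : Z ⟶ X` of integral schemes. -/
def functionFieldMap {Z X : Scheme.{u}} [IsIntegral Z] [IsIntegral X] (f : Z ⟶ X)
    [IsDominant f] : X.functionField ⟶ Z.functionField :=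
  X.presheaf.stalkSpecializes (specializes_of_eq (map_genericPoint f)) ≫
    f.stalkMap (genericPoint Z)

theorem germ_functionFieldMap {Z X : Scheme.{u}} [IsIntegral Z] [IsIntegral X] (f : Z ⟶ X)
    [IsDominant f] (U : X.Opens) (hU : genericPoint X ∈ U) :
    X.presheaf.germ U _ hU ≫ functionFieldMap f =
      f.app U ≫ Z.presheaf.germ (f ⁻¹ᵁ U) (genericPoint Z)
        (show f (genericPoint Z) ∈ U by rwa [map_genericPoint f]) := by
  unfold functionFieldMap
  rw [X.presheaf.germ_stalkSpecializes_assoc, Scheme.Hom.germ_stalkMap]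

theorem isDominant_of_isOpenImmersion {U X : Scheme.{u}} [IsIntegral U] [IsIntegral X]
    (a : U ⟶ X) [IsOpenImmersion a] : IsDominant a :=
  ⟨a.isOpenEmbedding.isOpen_range.dense (Set.range_nonempty a)⟩

/-- An open immersion of integral schemes identifies their function fields. -/
def functionFieldEquiv {U X : Scheme.{u}} [IsIntegral U] [IsIntegral X] (a : U ⟶ X)
    [IsOpenImmersion a] : X.functionField ≃+* U.functionField :=
  haveI := isDominant_of_isOpenImmersion a
  haveI : IsIso (functionFieldMap a) := by
    have h1 : IsIso (X.presheaf.stalkSpecializes (specializes_of_eq (map_genericPoint a))) :=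
      (X.presheaf.stalkCongr (.of_eq (map_genericPoint a).symm)).isIso_hom
    unfold functionFieldMap
    infer_instance
  (asIso (functionFieldMap a)).commRingCatIsoToRingEquiv

/-- The inclusion of the ground field in the function field of an integral `k`-scheme. -/
def constants {k : Type u} [Field k] {X : Scheme.{u}} [IsIntegral X] (s : X ⟶ Spec (.of k)) :
    k →+* X.functionField :=
  ((Scheme.ΓSpecIso (.of k)).inv ≫ s.appTop ≫
    X.presheaf.germ ⊤ (genericPoint X) trivial).hom

theorem functionFieldMap_constants {k : Type u} [Field k] {Z X : Scheme.{u}} [IsIntegral Z]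
    [IsIntegral X] (f : Z ⟶ X) [IsDominant f] (s : X ⟶ Spec (.of k)) (c : k) :
    functionFieldMap f (constants s c) = constants (f ≫ s) c := by
  have h := germ_functionFieldMap f ⊤ trivial
  have : (Scheme.ΓSpecIso (.of k)).inv ≫ s.appTop ≫
      X.presheaf.germ ⊤ (genericPoint X) trivial ≫ functionFieldMap f =
      (Scheme.ΓSpecIso (.of k)).inv ≫ (f ≫ s).appTop ≫
        Z.presheaf.germ ⊤ (genericPoint Z) trivial := by
    rw [h]; simp; rfl
  exact congr($(this) c)

/-! ## Weil divisors -/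

/-- A prime divisor, given by its generic point: a point of codimension one. -/
abbrev PrimeDivisor (X : Scheme.{u}) : Type u := {x : X // coheight x = 1}

/-- Weil divisors: finite `ℤ`-linear combinations of prime divisors. -/
abbrev WeilDivisor (X : Scheme.{u}) : Type u := PrimeDivisor X →₀ ℤ

theorem finite_primeDivisor_of_isClosed {X : Scheme.{u}} [IsIntegral X]
    [AlgebraicGeometry.IsNoetherian X] {C : Set X} (hC : IsClosed C)
    (hη : genericPoint X ∉ C) : {x : PrimeDivisor X | x.1 ∈ C}.Finite := by
  classical
  obtain ⟨S, hS, hSc, hSi, rfl⟩ :=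
    TopologicalSpace.NoetherianSpace.exists_finite_set_isClosed_irreducible hC
  have key : ∀ x : PrimeDivisor X, x.1 ∈ ⋃₀ S →
      ∃ (Z : Set X) (_ : Z ∈ S), x.1 ∈ Z ∧ closure {x.1} = Z := by
    rintro x ⟨Z, hZ, hxZ⟩
    refine ⟨Z, hZ, hxZ, ?_⟩
    obtain ⟨c, hc⟩ := QuasiSober.sober (hSi Z hZ) (hSc Z hZ)
    have hcx : c ⤳ x.1 := hc.specializes hxZ
    have hcη : genericPoint X ⤳ c := genericPoint_specializes c
    have hne : c ≠ genericPoint X := by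
      rintro rfl
      exact hη ⟨Z, hZ, hc.mem⟩
    by_cases hxc : x.1 ⤳ c
    · rw [(hxc.antisymm hcx).eq]
      exact hc
    · exfalso
      have h1 : x.1 < c :=
        ⟨Scheme.le_iff_specializes.mpr hcx, fun h => hxc (Scheme.le_iff_specializes.mp h)⟩
      have h2 : c < genericPoint X :=
        ⟨Scheme.le_iff_specializes.mpr hcη,
          fun h => hne ((Scheme.le_iff_specializes.mp h).antisymm hcη).eq⟩
      have h3 := coheight_add_one_le h1
      have h4 := coheight_add_one_le h2
      have h5 : (1 : ℕ∞) + 1 ≤ 1 := by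
        calc (1 : ℕ∞) + 1 ≤ (coheight (genericPoint X) + 1) + 1 := by gcongr; exact le_add_self
          _ ≤ coheight c + 1 := by gcongr
          _ ≤ coheight x.1 := h3
          _ = 1 := x.2
      exact absurd h5 (by decide)
  refine Set.Finite.of_finite_image (f := fun x : PrimeDivisor X => closure {x.1})
    (hS.subset ?_) ?_
  · rintro _ ⟨x, hx, rfl⟩
    obtain ⟨Z, hZ, -, h⟩ := key x hx
    simpa only [h] using hZ
  · intro x _ y _ h
    exact Subtype.ext (inseparable_iff_closure_eq.mpr h).eq

theorem finite_ord_ne_zero {X : Scheme.{u}} [IsIntegral X] [AlgebraicGeometry.IsNoetherian X]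
    (f : X.functionField) :
    (Function.support fun x : PrimeDivisor X => X.ord f x.1).Finite := by
  by_cases hf : f = 0
  · subst hf
    simp
  obtain ⟨U, -, f', hne, rfl, hu⟩ := exists_isUnit_germ_eq X f hf
  refine (finite_primeDivisor_of_isClosed (C := (U : Set X)ᶜ) U.2.isClosed_compl ?_).subset ?_
  · obtain ⟨x, hx⟩ := hne
    exact fun h => h (((genericPoint_spec X).mem_open_set_iff U.isOpen).mpr ⟨x, trivial, hx⟩)
  · intro x hx hxU
    exact hx (Scheme.ord_of_isUnit hu hxU)

/-- The divisor of zeros and poles of a nonzero rational function `f` (and `0` for `f = 0`). -/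
def principal {X : Scheme.{u}} [IsIntegral X] [AlgebraicGeometry.IsNoetherian X]
    (f : X.functionField) : WeilDivisor X :=
  Finsupp.ofSupportFinite (fun x => X.ord f x.1) (finite_ord_ne_zero f)

/-- Linear equivalence of Weil divisors. -/
def LinearlyEquivalent {X : Scheme.{u}} [IsIntegral X] [AlgebraicGeometry.IsNoetherian X]
    (D E : WeilDivisor X) : Prop :=
  ∃ f : X.functionField, f ≠ 0 ∧ E = D + principal f

open Classical in
/-- The multiplicity of a prime divisor `z` of `Z` in the pull-back of the Weil divisor `D` on `X`
along `p : Z ⟶ X`: if `p z` is the generic point of a prime divisor of `X`, it is the coefficient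
of the latter in `D` times the length of `𝒪_{Z,z} / 𝔪_{X,p z} 𝒪_{Z,z}`. -/
def pullbackCoeff {Z X : Scheme.{u}} (p : Z ⟶ X) (D : WeilDivisor X) (z : PrimeDivisor Z) : ℤ :=
  if h : coheight (p z.1) = 1 then
    D ⟨p z.1, h⟩ * ((Module.length (Z.presheaf.stalk z.1) (Z.presheaf.stalk z.1 ⧸
      (IsLocalRing.maximalIdeal (X.presheaf.stalk (p z.1))).map (p.stalkMap z.1).hom)).toNat : ℤ)
  else 0

theorem finite_pullbackCoeff_ne_zero {Z X : Scheme.{u}} [IsIntegral Z] [IsIntegral X]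
    [AlgebraicGeometry.IsNoetherian Z] (p : Z ⟶ X) [IsDominant p] (D : WeilDivisor X) :
    (Function.support (pullbackCoeff p D)).Finite := by
  classical
  refine Set.Finite.subset (D.support.finite_toSet.biUnion
    (t := fun x => {z : PrimeDivisor Z | z.1 ∈ p ⁻¹' closure {x.1}}) fun x _ =>
      finite_primeDivisor_of_isClosed (isClosed_closure.preimage p.continuous) ?_) ?_
  · intro h
    rw [Set.mem_preimage, map_genericPoint p] at h
    have h1 : x.1 = genericPoint X :=
      ((specializes_iff_mem_closure.mpr h).antisymm (genericPoint_specializes x.1)).eq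
    have h2 := x.2
    rw [h1, coheight_eq_zero.mpr] at h2
    · exact zero_ne_one h2
    · intro y _
      exact Scheme.le_iff_specializes.mpr (genericPoint_specializes y)
  · intro z hz
    rw [Function.mem_support, pullbackCoeff] at hz
    split_ifs at hz with h
    · refine Set.mem_biUnion (x := ⟨p z.1, h⟩) ?_ (subset_closure (Set.mem_singleton _))
      exact Finsupp.mem_support_iff.mpr (left_ne_zero_of_mul hz)
    · exact absurd rfl hz

/-- Flat pull-back of Weil divisors (used here for base field extensions). -/
def pullbackDivisor {Z X : Scheme.{u}} [IsIntegral Z] [IsIntegral X]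
    [AlgebraicGeometry.IsNoetherian Z] (p : Z ⟶ X) [IsDominant p] (D : WeilDivisor X) :
    WeilDivisor Z :=
  Finsupp.ofSupportFinite (pullbackCoeff p D) (finite_pullbackCoeff_ne_zero p D)

/-! ## Birational maps and birational transforms of divisors

A birational map `X ⇢ Y` of integral schemes is given by a common dense open subscheme, that is,
by open immersions `a : U ⟶ X` and `b : U ⟶ Y`. -/

/-- The identification `K(X) = K(Y)` given by a birational map. -/
def birationalEquiv {U X Y : Scheme.{u}} [IsIntegral U] [IsIntegral X] [IsIntegral Y]
    (a : U ⟶ X) (b : U ⟶ Y) [IsOpenImmersion a] [IsOpenImmersion b] :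
    X.functionField ≃+* Y.functionField :=
  (functionFieldEquiv a).trans (functionFieldEquiv b).symm

/-- `Corresponds a b x y`: the birational map `X ⇢ Y` is a local isomorphism at `x` and
sends `x` to `y`; that is, `𝒪_{X,x}` and `𝒪_{Y,y}` are the same subring of `K(X) = K(Y)`. -/
def Corresponds {U X Y : Scheme.{u}} [IsIntegral U] [IsIntegral X] [IsIntegral Y]
    (a : U ⟶ X) (b : U ⟶ Y) [IsOpenImmersion a] [IsOpenImmersion b] (x : X) (y : Y) : Prop :=
  (algebraMap (X.presheaf.stalk x) X.functionField).range.map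
      (birationalEquiv a b).toRingHom =
    (algebraMap (Y.presheaf.stalk y) Y.functionField).range

open Classical in
/-- The birational (proper) transform of a Weil divisor: a prime divisor of `X` is sent
to the closure of its image if that is a prime divisor of `Y` (it is then unique, because `Y` is
separated), and to `0` if it is contracted; this is extended additively. -/
def divisorTransform {U X Y : Scheme.{u}} [IsIntegral U] [IsIntegral X] [IsIntegral Y]
    (a : U ⟶ X) (b : U ⟶ Y) [IsOpenImmersion a] [IsOpenImmersion b] (D : WeilDivisor X) :
    WeilDivisor Y :=
  D.sum fun x m =>
    if h : ∃ y : PrimeDivisor Y, Corresponds a b x.1 y.1 then Finsupp.single h.choose m else 0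

/-! ## Extension of the base field -/

section BaseChange

variable {k : Type u} [Field k] {X Y Z : Scheme.{u}}

/-- The base change `X_K` of a `k`-scheme `s : X ⟶ Spec k` to an extension `K` of `k`. -/
def BaseChange (s : X ⟶ Spec (.of k)) (K : Type u) [Field K] [Algebra k K] : Scheme.{u} :=
  pullback s (Spec.map (CommRingCat.ofHom (algebraMap k K)))

variable (s : X ⟶ Spec (.of k)) (K : Type u) [Field K] [Algebra k K]

/-- The projection `X_K ⟶ X`. -/
def BaseChange.proj : BaseChange s K ⟶ X := pullback.fst _ _

/-- The structure morphism `X_K ⟶ Spec K`. -/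
def BaseChange.str : BaseChange s K ⟶ Spec (.of K) := pullback.snd _ _

/-- The morphism `Z_K ⟶ X_K` induced by a morphism `f : Z ⟶ X` over `k`. -/
def BaseChange.map {sX : X ⟶ Spec (.of k)} {sZ : Z ⟶ Spec (.of k)} (f : Z ⟶ X)
    (h : sZ = f ≫ sX) : BaseChange sZ K ⟶ BaseChange sX K :=
  pullback.map _ _ _ _ f (𝟙 _) (𝟙 _) (by simp [h]) (by simp)

instance [GeometricallyIntegral s] : IsIntegral (BaseChange s K) := by
  unfold BaseChange; infer_instance

instance : IsDominant (BaseChange.proj s K) :=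
  inferInstanceAs (IsDominant (pullback.fst s (Spec.map (CommRingCat.ofHom (algebraMap k K)))))

instance [IsProper s] : IsProper (BaseChange.str s K) :=
  inferInstanceAs (IsProper (pullback.snd s (Spec.map (CommRingCat.ofHom (algebraMap k K)))))

instance [IsProper s] : AlgebraicGeometry.IsNoetherian (BaseChange s K) := by
  have := LocallyOfFiniteType.isLocallyNoetherian (BaseChange.str s K)
  have : CompactSpace (BaseChange s K) :=
    QuasiCompact.compactSpace_of_compactSpace (BaseChange.str s K)
  exact {}

instance {sX : X ⟶ Spec (.of k)} {sZ : Z ⟶ Spec (.of k)} (f : Z ⟶ X)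
    (h : sZ = f ≫ sX) [IsOpenImmersion f] : IsOpenImmersion (BaseChange.map K f h) :=
  inferInstanceAs (IsOpenImmersion (pullback.map sZ _ sX _ f (𝟙 _) (𝟙 _)
    (by simp [h]) (by simp)))

end BaseChange

/-! ## Linear systems -/

theorem isDiscreteValuationRing_stalk {X : Scheme.{u}} [IsIntegral X] [IsLocallyNoetherian X]
    [IsNormalScheme X] {x : X} (hx : coheight x = 1) :
    IsDiscreteValuationRing (X.presheaf.stalk x) := by
  have hdim : ringKrullDim (X.presheaf.stalk x) = 1 := by
    rw [ringKrullDim_stalk_eq_coheight, hx]; rfl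
  have hf : ¬ IsField (X.presheaf.stalk x) := by
    intro h
    rw [ringKrullDim_eq_zero_of_isField h] at hdim
    exact zero_ne_one hdim
  have : Ring.KrullDimLE 1 (X.presheaf.stalk x) := krullDimLE_of_coheight_le hx.le
  have h03 := (IsDiscreteValuationRing.TFAE (X.presheaf.stalk x) hf).out 0 3
  refine h03.mpr ⟨IsNormalScheme.isIntegrallyClosed_stalk x,
    IsLocalRing.maximalIdeal (X.presheaf.stalk x), ⟨?_, inferInstance⟩, ?_⟩
  · exact fun h => hf (IsLocalRing.isField_iff_maximalIdeal_eq.mpr h)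
  · rintro P ⟨hP, hP'⟩
    exact IsLocalRing.eq_maximalIdeal (Ideal.IsPrime.isMaximal_of_ne_bot hP' hP)

section LinearSystem

variable {k : Type u} [Field k] {U X Y : Scheme.{u}}

/-- The `k`-linear combination `∑ cᵢ fᵢ` of rational functions on a `k`-scheme. -/
def linComb [IsIntegral X] (s : X ⟶ Spec (.of k)) {n : ℕ} (f : Fin (n + 1) → X.functionField)
    (c : Fin (n + 1) → k) : X.functionField :=
  ∑ i, constants s (c i) * f i

/-- A (not necessarily complete) linear system on a `k`-variety `X`, with homogeneous coordinates
on it: a Weil divisor `D` and a basis `f₀, …, fₙ` of a nonzero finite dimensional `k`-subspace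
`V ⊆ H⁰(X, 𝒪_X(D)) ⊆ K(X)`. The linear system `|D|` is the projective space of lines in `V`;
the line spanned by `f = ∑ cᵢ fᵢ` corresponds to the effective divisor `D + (f)`. -/
structure LinearSystem [IsIntegral X] [AlgebraicGeometry.IsNoetherian X]
    (s : X ⟶ Spec (.of k)) where
  dim : ℕ
  divisor : WeilDivisor X
  basis : Fin (dim + 1) → X.functionField
  linearIndependent : ∀ c : Fin (dim + 1) → k, linComb s basis c = 0 → c = 0
  effective : ∀ c : Fin (dim + 1) → k, c ≠ 0 → 0 ≤ divisor + principal (linComb s basis c)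

/-- The projective space `|D|`, through its `K`-points: the lines in `K ⊗ V = K^{n+1}`. -/
abbrev LinearSystem.Points [IsIntegral X] [AlgebraicGeometry.IsNoetherian X]
    {s : X ⟶ Spec (.of k)} (L : LinearSystem s) (K : Type u) [Field K] : Type u :=
  ℙ K (Fin (L.dim + 1) → K)

/-- `|D|` has no fixed components: no prime divisor of `X` is contained in all members. -/
def LinearSystem.NoFixedComponents [IsIntegral X] [AlgebraicGeometry.IsNoetherian X]
    {s : X ⟶ Spec (.of k)} (L : LinearSystem s) : Prop :=
  ∀ x : PrimeDivisor X, ∃ c : Fin (L.dim + 1) → k, c ≠ 0 ∧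
    (L.divisor + principal (linComb s L.basis c)) x = 0

/-- The member `D_λ` of `|D|`, a Weil divisor on `X_K`, for a `K`-point `λ` of `|D|`: if
`λ = (c₀ : … : cₙ)`, then `D_λ = D_K + (∑ cᵢ fᵢ)`. -/
def LinearSystem.member [IsIntegral X] [AlgebraicGeometry.IsNoetherian X]
    {s : X ⟶ Spec (.of k)} [IsProper s] [GeometricallyIntegral s] (L : LinearSystem s)
    {K : Type u} [Field K] [Algebra k K] (v : L.Points K) : WeilDivisor (BaseChange s K) :=
  pullbackDivisor (BaseChange.proj s K) L.divisor +
    principal (linComb (BaseChange.str s K)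
      (fun i => functionFieldMap (BaseChange.proj s K) (L.basis i)) v.rep)

/-- The set of all members of `|D|_K`. -/
def LinearSystem.members [IsIntegral X] [AlgebraicGeometry.IsNoetherian X]
    {s : X ⟶ Spec (.of k)} [IsProper s] [GeometricallyIntegral s] (L : LinearSystem s)
    (K : Type u) [Field K] [Algebra k K] : Set (WeilDivisor (BaseChange s K)) :=
  Set.range fun v : L.Points K => L.member v

/-- The linear system `|D_λ : λ ∈ Λ|` spanned by a set `S = {D_λ}` of linearly equivalent Weil
divisors, as a set of divisors: if `D₀ ∈ S` and `V` is the `k`-span of all `h` with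
`D₀ + (h) ∈ S`, it consists of the `D₀ + (f)` for nonzero `f ∈ V`. -/
def spannedSystem [IsIntegral X] [AlgebraicGeometry.IsNoetherian X] (s : X ⟶ Spec (.of k))
    (S : Set (WeilDivisor X)) : Set (WeilDivisor X) :=
  letI := (constants s).toAlgebra
  {E | ∃ D₀ ∈ S, ∃ f ∈ Submodule.span k {h : X.functionField | h ≠ 0 ∧ D₀ + principal h ∈ S},
    f ≠ 0 ∧ E = D₀ + principal f}

/-! ## Birational transforms of linear systems -/

/-- The largest `m : ℤ` such that all `fᵢ` vanish to order at least `m` along `y`. -/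
def minOrd [IsIntegral Y] [IsLocallyNoetherian Y] {n : ℕ} (f : Fin (n + 1) → Y.functionField)
    (y : Y) : ℤ :=
  Finset.univ.inf' Finset.univ_nonempty fun i => Y.ord (f i) y

theorem finite_minOrd_ne_zero [IsIntegral Y] [AlgebraicGeometry.IsNoetherian Y] {n : ℕ}
    (f : Fin (n + 1) → Y.functionField) :
    (Function.support fun y : PrimeDivisor Y => -minOrd f y.1).Finite := by
  refine (Set.finite_iUnion fun i => finite_ord_ne_zero (f i)).subset fun y hy => ?_
  obtain ⟨i, -, hi⟩ := Finset.exists_mem_eq_inf' (Finset.univ_nonempty (α := Fin (n + 1)))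
    fun i => Y.ord (f i) y.1
  refine Set.mem_iUnion.mpr ⟨i, ?_⟩
  have h : -minOrd f y.1 ≠ 0 := hy
  rw [minOrd, hi] at h
  exact neg_ne_zero.mp h

theorem constants_ne_zero [IsIntegral X] (s : X ⟶ Spec (.of k)) {c : k} (hc : c ≠ 0) :
    constants s c ≠ 0 := (map_ne_zero _).mpr hc

theorem ord_constants [IsIntegral X] [IsLocallyNoetherian X] (s : X ⟶ Spec (.of k)) {c : k}
    (hc : c ≠ 0) (x : X) : X.ord (constants s c) x = 0 := by
  have hu : IsUnit ((((Scheme.ΓSpecIso (.of k)).inv ≫ s.appTop).hom) c) :=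
    (isUnit_iff_ne_zero.mpr hc).map _
  have : Nonempty (⊤ : X.Opens) := ⟨⟨x, trivial⟩⟩
  exact Scheme.ord_of_isUnit (U := ⊤) hu trivial

theorem minOrd_le_ord_linComb [IsIntegral Y] [IsLocallyNoetherian Y] [IsNormalScheme Y]
    (s : Y ⟶ Spec (.of k)) {n : ℕ} (f : Fin (n + 1) → Y.functionField) (c : Fin (n + 1) → k)
    {y : Y} (hy : coheight y = 1) (h : linComb s f c ≠ 0) :
    minOrd f y ≤ Y.ord (linComb s f c) y := by
  have := isDiscreteValuationRing_stalk hy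
  have key : ∀ g : Y.functionField, g = linComb s f c → g = 0 ∨ minOrd f y ≤ Y.ord g y := by
    rintro _ rfl
    unfold linComb
    refine Finset.sum_induction _ (fun g => g = 0 ∨ minOrd f y ≤ Y.ord g y) ?_ (.inl rfl) ?_
    · rintro a b ha hb
      by_cases ha0 : a = 0
      · simpa [ha0] using hb
      by_cases hb0 : b = 0
      · simpa [hb0] using ha
      by_cases hab : a + b = 0
      · exact .inl hab
      · exact .inr ((le_min (ha.resolve_left ha0) (hb.resolve_left hb0)).trans
          (Scheme.ord_add hab))
    · intro i _
      by_cases hi : constants s (c i) * f i = 0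
      · exact .inl hi
      · have hc : c i ≠ 0 := by rintro hc; simp [hc] at hi
        right
        rw [Scheme.ord_mul (left_ne_zero_of_mul hi) (right_ne_zero_of_mul hi),
          ord_constants s hc, zero_add]
        exact Finset.inf'_le _ (Finset.mem_univ i)
  exact (key _ rfl).resolve_left h

theorem birationalEquiv_linComb [IsIntegral U] [IsIntegral X] [IsIntegral Y]
    (a : U ⟶ X) (b : U ⟶ Y) [IsOpenImmersion a] [IsOpenImmersion b] {sX : X ⟶ Spec (.of k)}
    {sY : Y ⟶ Spec (.of k)} (h : a ≫ sX = b ≫ sY) {n : ℕ} (f : Fin (n + 1) → X.functionField)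
    (c : Fin (n + 1) → k) :
    birationalEquiv a b (linComb sX f c) = linComb sY (fun i => birationalEquiv a b (f i)) c := by
  have := isDominant_of_isOpenImmersion a
  have := isDominant_of_isOpenImmersion b
  have hc : ∀ c : k, birationalEquiv a b (constants sX c) = constants sY c := by
    intro c
    have h1 : functionFieldEquiv a (constants sX c) = functionFieldEquiv b (constants sY c) := by
      change functionFieldMap a (constants sX c) = functionFieldMap b (constants sY c)
      simp only [functionFieldMap_constants, h]
    rw [birationalEquiv, RingEquiv.trans_apply, h1, RingEquiv.symm_apply_apply]
  simp only [linComb, map_sum, map_mul, hc]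

/-- The birational transform `g_*|D|` of a linear system `|D|` without fixed components under a
birational map `g : X ⇢ Y` over `k`: the linear system without fixed components on `Y`, with
the same parameter space, whose members have the same restriction to the common
open subscheme as those of `|D|`. (Equivalently, its incidence correspondence in `Y × |D|`
is the closure of that of `|D|`.) Thus it has the same rational functions `fᵢ ∈ K(X) = K(Y)`, and
the coefficient in its divisor of a prime divisor `y` of `Y` is `-min ord_y(fᵢ)`. -/
def LinearSystem.transform [IsIntegral U] [IsIntegral X] [AlgebraicGeometry.IsNoetherian X]
    [IsIntegral Y] [AlgebraicGeometry.IsNoetherian Y] [IsNormalScheme Y]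
    {sX : X ⟶ Spec (.of k)} {sY : Y ⟶ Spec (.of k)} (L : LinearSystem sX)
    (a : U ⟶ X) (b : U ⟶ Y) [IsOpenImmersion a] [IsOpenImmersion b] (h : a ≫ sX = b ≫ sY) :
    LinearSystem sY where
  dim := L.dim
  divisor := Finsupp.ofSupportFinite _
    (finite_minOrd_ne_zero fun i => birationalEquiv a b (L.basis i))
  basis i := birationalEquiv a b (L.basis i)
  linearIndependent c hc := by
    rw [← birationalEquiv_linComb a b h] at hc
    exact L.linearIndependent c ((map_eq_zero_iff _ (birationalEquiv a b).injective).mp hc)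
  effective c hc y := by
    have h0 : linComb sY (fun i => birationalEquiv a b (L.basis i)) c ≠ 0 := by
      rw [← birationalEquiv_linComb a b h]
      exact fun h' => hc (L.linearIndependent c
        ((map_eq_zero_iff _ (birationalEquiv a b).injective).mp h'))
    have h1 := minOrd_le_ord_linComb sY _ c y.2 h0
    change 0 ≤ -minOrd _ y.1 + Y.ord _ y.1
    linarith

end LinearSystem

section PartialIso

variable {k : Type u} [Field k] {X Y : Scheme.{u}}

instance [IsIntegral X] (g : X.PartialIso Y) : Nonempty g.source.toScheme :=
  have ⟨x, hx⟩ := g.dense_source.nonempty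
  ⟨⟨x, hx⟩⟩

instance (sX : X ⟶ Spec (.of k)) [IsIntegral X] [GeometricallyIntegral sX]
    (g : X.PartialIso Y) (K : Type u) [Field K] [Algebra k K] :
    IsIntegral (BaseChange (g.source.ι ≫ sX) K) := by
  have : Surjective (BaseChange.proj (g.source.ι ≫ sX) K) :=
    inferInstanceAs (Surjective (pullback.fst (g.source.ι ≫ sX)
      (Spec.map (CommRingCat.ofHom (algebraMap k K)))))
  obtain ⟨x⟩ : Nonempty g.source.toScheme := inferInstance
  have : Nonempty (BaseChange (g.source.ι ≫ sX) K) :=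
    ⟨((BaseChange.proj (g.source.ι ≫ sX) K).surjective x).choose⟩
  exact isIntegral_of_isOpenImmersion (BaseChange.map K (sX := sX) g.source.ι rfl)

theorem isOver_comp {sX : X ⟶ Spec (.of k)} {sY : Y ⟶ Spec (.of k)} {g : X.PartialIso Y}
    (hg : g.IsOver sX sY) : g.source.ι ≫ sX = (g.iso.hom ≫ g.target.ι) ≫ sY := by
  rw [Category.assoc]; exact Eq.symm hg

/-- The birational transform `g_*|D|`, for a birational map `g` over `k` given as an isomorphism
between dense open subschemes. -/
def LinearSystem.birTransform [IsIntegral X] [AlgebraicGeometry.IsNoetherian X]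
    [IsIntegral Y] [AlgebraicGeometry.IsNoetherian Y] [IsNormalScheme Y]
    {sX : X ⟶ Spec (.of k)} {sY : Y ⟶ Spec (.of k)} (L : LinearSystem sX)
    (g : X.PartialIso Y) (hg : g.IsOver sX sY) : LinearSystem sY :=
  L.transform g.source.ι (g.iso.hom ≫ g.target.ι) (isOver_comp hg)

/-- The birational transform `g_*(D)` of a Weil divisor `D` on `X_K` under (the base change to `K`
of) a birational map `g` over `k`. -/
def birTransformDivisor [IsIntegral X] [IsIntegral Y] {sX : X ⟶ Spec (.of k)}
    {sY : Y ⟶ Spec (.of k)} [GeometricallyIntegral sX] [GeometricallyIntegral sY]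
    (g : X.PartialIso Y) (hg : g.IsOver sX sY) {K : Type u} [Field K] [Algebra k K]
    (D : WeilDivisor (BaseChange sX K)) : WeilDivisor (BaseChange sY K) :=
  divisorTransform (BaseChange.map K g.source.ι rfl)
    (BaseChange.map K (g.iso.hom ≫ g.target.ι) (isOver_comp hg)) D

end PartialIso

/-! ## Subvarieties of the projective space `|D|` -/

/-- The `k`-Zariski topology on the set of `K`-points of `ℙⁿ`: the complements of the zero sets of
homogeneous polynomials with coefficients in `k` form a basis of open sets. -/
abbrev zariski (k : Type u) [Field k] (K : Type u) [Field K] [Algebra k K] (n : ℕ) :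
    TopologicalSpace (ℙ K (Fin (n + 1) → K)) :=
  .generateFrom {O | ∃ (d : ℕ) (F : MvPolynomial (Fin (n + 1)) k), F.IsHomogeneous d ∧
    O = {v | MvPolynomial.aeval v.rep F ≠ 0}}

/-- A geometrically irreducible (locally closed) `k`-subvariety of `ℙⁿ`, given by the set of its
points over the algebraic closure `K` of `k`. -/
structure IsGeomIrreducibleSubvariety (k : Type u) [Field k] {K : Type u} [Field K] [Algebra k K]
    {n : ℕ} (W : Set (ℙ K (Fin (n + 1) → K))) : Prop where
  isLocallyClosed : @IsLocallyClosed _ (zariski k K n) W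
  isIrreducible : @IsIrreducible _ (zariski K K n) W

/-- `O` is a dense open subset of the `k`-subvariety `W` of `ℙⁿ`. -/
def IsDenseOpenIn (k : Type u) [Field k] {K : Type u} [Field K] [Algebra k K] {n : ℕ}
    (O W : Set (ℙ K (Fin (n + 1) → K))) : Prop :=
  (∃ G, @IsOpen _ (zariski k K n) G ∧ O = G ∩ W) ∧ W ⊆ @closure _ (zariski k K n) O

end WeilLinearSystem

end

open WeilLinearSystem

/-! Write `f_λ = ∑ cᵢ fᵢ` for the rational function attached to `λ`. Absence of fixed components
forces the coefficient of `D` at a prime divisor `x` to be `-min ord_x(fᵢ)`, and `g_*|D|` is defined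
by the same recipe on `Y`. This passes to `K`, since orders of pulled-back functions are multiplied
by the same length that defines the pull-back of divisors. So on either side the member at `λ` has
coefficient `-min ord(fᵢ) + ord(f_λ)`.

At a prime divisor `y` of `Y_K` that corresponds to one of `X_K`, the local rings agree inside the
function field, hence so do all orders, and `g_*(D_λ)` and the member of `g_*|D|` have the same
coefficient (`divisorTransform_member_apply`). Only finitely many `y` correspond to nothing
(`finite_not_corresponds`). There `g_*(D_λ)` has coefficient `0`, and the member of `g_*|D|` does
too as soon as `f_λ` has minimal order, which holds off a hyperplane
(`exists_linComb_ord_eq_minOrd`). Each of these hyperplanes, together with its Galois conjugates, is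
cut out by a form over `k`; as `W` is irreducible and spans, removing them leaves a dense open `W₀`
that still spans (`exists_isDenseOpenIn`). On `W₀` the divisor `g_*(D_λ)` is the member of `g_*|D|`
at `λ`, which gives linear equivalence.

It remains to see that spanning members generate exactly `g_*|D|`
(`LinearSystem.members_eq_spannedSystem`). A divisor must determine its function up to a constant: a
function `u` on `Y_K` with zero divisor lies in `K`. Over an imperfect field `Y_K` may fail to be
normal, so orders do not detect regularity, and the argument descends to the normal `Y` instead
(`mem_range_constants_of_ord_eq_zero`). Some power of `u` lies in `F(θ)`, where `F = K(Y)` and `θ ∈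
K` is separable over `k`. For a local ring `A` of `Y` in codimension one, the normalization of `A`
in `F(θ)` lies in `A[θ]` because the discriminant is a unit, so a pole of the power would show up at
a codimension one point of `Y_K`. Hence the power is integral over every such `A`; the coefficients
of its minimal polynomial over `F` are then global functions on the proper normal `Y` by Hartogs,
thus algebraic over `k`, and so is `u`. -/

/-! ### Commutative algebra: Hartogs, separable generation, detecting poles. -/

/-- Algebraic Hartogs: a fraction that is regular at all primes of height one of a normal
Noetherian domain is regular. -/
theorem mem_range_algebraMap_of_forall_height_eq_one {R F : Type*} [CommRing R] [IsDomain R]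
    [IsNoetherianRing R] [IsIntegrallyClosed R] [Field F] [Algebra R F] [IsFractionRing R F]
    (f : F) (h : ∀ p : Ideal R, p.IsPrime → p.height = 1 →
      ∃ s ∉ p, s • f ∈ (algebraMap R F).range) :
    f ∈ (algebraMap R F).range := by
  by_contra hf
  -- `I g` is the ideal of denominators of `g`. A maximal one among those of multiples `x • f`
  -- outside `R` is an associated prime of `F / R`; it will turn out to have height one.
  let I : F → Ideal R := fun g =>
    (LinearMap.range (Algebra.linearMap R F)).comap (LinearMap.toSpanSingleton R F g)
  have memI : ∀ g c, c ∈ I g ↔ c • g ∈ (algebraMap R F).range := fun g c => Iff.rfl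
  obtain ⟨-, ⟨x, hx, rfl⟩, hmax⟩ := set_has_maximal_iff_noetherian.mpr ‹IsNoetherianRing R›
    {J | ∃ x : R, x • f ∉ (algebraMap R F).range ∧ J = I (x • f)}
    ⟨I f, 1, by rwa [one_smul], by rw [one_smul]⟩
  set g := x • f with hg
  have hp : (I g).IsPrime := by
    refine ⟨fun h1 => hx (by simpa using (memI g 1).mp (h1 ▸ trivial)), fun {a b} hab => ?_⟩
    by_contra! hc
    refine hmax (I (a • g)) ⟨a * x, ?_, by rw [hg, mul_smul]⟩ (lt_of_le_of_ne ?_ ?_)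
    · rw [mul_smul]; exact hc.1
    · intro c hc
      rw [memI] at hc ⊢
      obtain ⟨r, hr⟩ := hc
      exact ⟨a * r, by rw [map_mul, hr, smul_comm c a g, Algebra.smul_def a (c • g)]⟩
    · intro he
      apply hc.2
      rw [he, memI, ← mul_smul, mul_comm]
      exact hab
  have hne : I g ≠ ⊥ := by
    obtain ⟨⟨n, d⟩, hd⟩ := IsLocalization.surj (nonZeroDivisors R) g
    refine fun hb => nonZeroDivisors.ne_zero d.2 ((Submodule.mem_bot R).mp ?_)
    rw [← hb, memI]
    exact ⟨n, by rw [← hd, Algebra.smul_def, mul_comm]⟩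
  have hsF : ∀ s ∉ I g, s • f ∉ (algebraMap R F).range := by
    rintro s hs ⟨r, hr⟩
    exact hs ((memI _ _).mpr ⟨x * r, by rw [map_mul, hr, hg, smul_comm, Algebra.smul_def x]⟩)
  -- Either `g` maps the finitely generated ideal `I g` into itself, and is integral by the
  -- determinant trick, or some `t = a g` lies outside `I g`. In the second case `t c ∈ (a)` for all
  -- `c ∈ I g` makes `I g` minimal over `(a)`, and Krull's theorem bounds its height.
  by_cases hc : ∀ a ∈ I g, ∀ t, algebraMap R F t = a • g → t ∈ I g
  · apply hx
    refine IsIntegrallyClosed.isIntegral_iff.mp ?_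
    refine isIntegral_of_smul_mem_submodule (Submodule.map (Algebra.linearMap R F) (I g)) ?_ ?_ g ?_
    · exact fun h => hne (Submodule.map_injective_of_injective
        (f := Algebra.linearMap R F) (IsFractionRing.injective R F) (h.trans (by simp)))
    · exact (IsNoetherian.noetherian (I g)).map _
    · rintro _ ⟨a, ha, rfl⟩
      obtain ⟨t, ht⟩ := (memI _ _).mp ha
      refine ⟨t, hc a ha t ht, ?_⟩
      rw [Algebra.linearMap_apply, ht, Algebra.linearMap_apply, Algebra.smul_def, smul_eq_mul, mul_comm]
  · push Not at hc
    obtain ⟨a, ha, t, ht, htI⟩ := hc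
    have hmin : I g ∈ (Ideal.span {a}).minimalPrimes := by
      refine ⟨⟨hp, by simpa [Ideal.span_singleton_le_iff_mem] using ha⟩, ?_⟩
      rintro q ⟨hq, haq⟩ hqI c hcI
      obtain ⟨r, hr⟩ := (memI _ _).mp hcI
      have : t * c = a * r := IsFractionRing.injective R F (by
        rw [map_mul, map_mul, ht, hr, Algebra.smul_def, Algebra.smul_def]; ring)
      refine (hq.mem_or_mem (x := t) (y := c) ?_).resolve_left fun h => htI (hqI h)
      rw [this]
      exact q.mul_mem_right _ (haq (Ideal.mem_span_singleton_self a))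
    have h1 : (I g).height ≤ 1 := Ideal.height_le_one_of_isPrincipal_of_mem_minimalPrimes _ _ hmin
    have h2 : (I g).height ≠ 0 := Ideal.height_eq_zero_iff_eq_bot.not.mpr hne
    obtain ⟨s, hs, hs'⟩ := h _ hp (le_antisymm h1 (Order.one_le_iff_ne_zero.mpr h2))
    exact hsF s hs hs'

/-- If `M = F[K]` is generated by subfields and `K` is algebraic over a subfield `k` of `F ∩ K`,
then every element of `M` has a power in `F(θ)`, for a separable element `θ` of `K`. -/
theorem exists_pow_mem_adjoin_separable {k K F M : Type*} [Field k] [Field K] [Field F] [Field M]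
    [Algebra k K] [Algebra.IsAlgebraic k K] [Algebra k F] [Algebra F M] [Algebra K M] [Algebra k M]
    [IsScalarTower k F M] [IsScalarTower k K M] {u : M}
    (hu : u ∈ Algebra.adjoin F (Set.range (algebraMap K M))) :
    ∃ n > 0, ∃ θ : K, IsSeparable k θ ∧
      u ^ n ∈ IntermediateField.adjoin F {algebraMap K M θ} := by
  classical
  -- The exponential characteristic is `1` in characteristic zero, where all powers below are
  -- trivial.
  let q := ringExpChar k
  have : ExpChar M q := expChar_of_injective_ringHom (algebraMap k M).injective q
  let S : Set M := algebraMap K M '' (separableClosure k K)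
  let R := Algebra.adjoin F S
  have : ExpChar R q := expChar_of_injective_algebraMap (R := k) (algebraMap k R).injective q
  have h1 : ∃ n : ℕ, u ^ q ^ n ∈ R := by
    -- Elements with a `q ^ n`-th power in `R` form a subalgebra, because Frobenius is additive, so
    -- it is enough to treat generators; `K` is purely inseparable over the separable closure of `k`
    -- in it.
    have : u ∈ (Subalgebra.perfectClosure R M q) := by
      induction hu using Algebra.adjoin_induction with
      | mem x hx =>
        obtain ⟨c, rfl⟩ := hx
        obtain ⟨n, y, hy⟩ := IsPurelyInseparable.pow_mem (separableClosure k K) q c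
        refine Subalgebra.mem_perfectClosure_iff.mpr ⟨n,
          ⟨algebraMap K M y, Algebra.subset_adjoin ⟨y, y.2, rfl⟩⟩, ?_⟩
        rw [← map_pow, ← hy]
        rfl
      | algebraMap r => exact Subalgebra.algebraMap_mem _ (algebraMap F R r)
      | add x y _ _ hx hy => exact add_mem hx hy
      | mul x y _ _ hx hy => exact mul_mem hx hy
    obtain ⟨n, r, hr⟩ := Subalgebra.mem_perfectClosure_iff.mp this
    exact ⟨n, hr ▸ r.2⟩
  obtain ⟨n, hn⟩ := h1
  refine ⟨q ^ n, pow_pos (expChar_pos k q) _, ?_⟩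
  obtain ⟨T, hTS, hT⟩ := IntermediateField.exists_finset_of_mem_adjoin
    (IntermediateField.algebra_adjoin_le_adjoin F S hn)
  obtain ⟨T', hTS', rfl⟩ := Finset.subset_set_image_iff.mp hTS
  let L := IntermediateField.adjoin k (T' : Set K)
  have hL : Algebra.IsSeparable k L :=
    (IntermediateField.isSeparable_adjoin_iff_isSeparable k K).mpr fun x hx =>
      mem_separableClosure_iff.mp (hTS' hx)
  have : FiniteDimensional k L := IntermediateField.finiteDimensional_adjoin
    fun x _ => Algebra.IsIntegral.isIntegral x
  obtain ⟨θ, hθ⟩ := Field.exists_primitive_element k L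
  refine ⟨θ, (Algebra.IsSeparable.isSeparable k θ).map L.val L.val.injective, ?_⟩
  have hTL : (T' : Set K) ⊆ IntermediateField.adjoin k {(θ : K)} := by
    rw [← IntermediateField.lift_adjoin_simple, hθ, IntermediateField.lift_top]
    exact IntermediateField.subset_adjoin k _
  refine IntermediateField.adjoin_le_iff.mpr ?_ hT
  rw [Finset.coe_image]
  rintro _ ⟨c, hc, rfl⟩
  have h2 : IntermediateField.adjoin k {(θ : K)} ≤ ((IntermediateField.adjoin F
      {algebraMap K M θ}).restrictScalars k).comap (IsScalarTower.toAlgHom k K M) :=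
    IntermediateField.adjoin_simple_le_iff.mpr
      (IntermediateField.mem_adjoin_simple_self F (algebraMap K M θ))
  exact h2 (hTL hc)

open IsDedekindDomain in
/-- Let `A ⊆ F` be a discrete valuation ring containing a field `k`, and `θ` a separable element
of an extension `M` of `F` which is algebraic over `k`. An element `w` of `F(θ)` which is not
integral over `A` has a pole at some prime of every integral extension `C ⊆ M` of `A`
containing `θ`. -/
theorem exists_prime_of_not_isIntegral {k A F M : Type*} [Field k] [CommRing A] [IsDomain A]
    [IsDiscreteValuationRing A] [Field F] [Field M] [Algebra A F] [IsFractionRing A F]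
    [Algebra F M] [Algebra A M] [IsScalarTower A F M] [Algebra k A] [Algebra k F]
    [IsScalarTower k A F] [Algebra k M] [IsScalarTower k F M] {θ : M} (hθ : IsIntegral k θ)
    (hθs : IsSeparable F θ) {w : M} (hw : w ∈ IntermediateField.adjoin F {θ})
    (hwA : ¬ IsIntegral A w) (C : Subalgebra A M) [Algebra.IsIntegral A C] (hθC : θ ∈ C) :
    ∃ Q : Ideal C, Q.IsPrime ∧ Q.comap (algebraMap A C) = IsLocalRing.maximalIdeal A ∧
      ∃ s ∈ Q, ∃ t ∉ Q, w * s = t := by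
  let E := IntermediateField.adjoin F {θ}
  have hθF : IsIntegral F θ := hθ.tower_top
  have : FiniteDimensional F E := IntermediateField.adjoin.finiteDimensional hθF
  have : Algebra.IsSeparable F E :=
    (IntermediateField.isSeparable_adjoin_simple_iff_isSeparable F M).mpr hθs
  have : IsScalarTower A E M := .of_algebraMap_eq fun _ => rfl
  have : IsScalarTower k A M := .of_algebraMap_eq fun x => by
    rw [IsScalarTower.algebraMap_apply A F M, ← IsScalarTower.algebraMap_apply k A F,
      ← IsScalarTower.algebraMap_apply k F M]
  have : IsScalarTower k A E := .of_algebraMap_eq fun x => Subtype.ext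
    (IsScalarTower.algebraMap_apply k A M x)
  let B := integralClosure A E
  have : IsDedekindDomain B := integralClosure.isDedekindDomain A F E
  have : IsFractionRing B E := integralClosure.isFractionRing_of_finite_extension F E
  -- The normalization `B` of `A` in `F(θ)` is Dedekind, by separability of `θ`, and `w ∉ B`, so `w`
  -- has a pole at some prime. Below, `w⁻¹ = n / d` with `n` in that prime and `d` outside it.
  obtain ⟨v, hv⟩ : ∃ v : HeightOneSpectrum B, 1 < v.valuation E ⟨w, hw⟩ := by
    by_contra! h
    obtain ⟨b, hb⟩ := HeightOneSpectrum.mem_integers_of_valuation_le_one E ⟨w, hw⟩ h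
    have := b.2.map (IsScalarTower.toAlgHom A E M)
    apply hwA
    convert this
    exact congr_arg Subtype.val hb.symm
  have hw0 : (⟨w, hw⟩ : E) ≠ 0 := by
    intro h
    rw [h, map_zero] at hv
    exact absurd hv (by simp)
  have hv' : v.valuation E (⟨w, hw⟩ : E)⁻¹ < 1 := by
    rw [map_inv₀]
    exact inv_lt_one_of_one_lt₀ hv
  obtain ⟨n, d, hnd⟩ := HeightOneSpectrum.exists_primeCompl_mul_eq_of_integer v _ hv'.le
  have hn : n ∈ v.asIdeal := by
    refine (v.valuation_lt_one_iff_mem (K := E) n).mp ?_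
    refine (congr_arg (v.valuation E) hnd.symm).trans_lt ?_
    rw [map_mul]
    exact mul_lt_one_of_nonneg_of_lt_one_left zero_le hv' (v.valuation_le_one _)
  -- The discriminant `δ` of the powers of `θ` satisfies `δ B ⊆ A[θ]`. It is algebraic over the
  -- field `k`, so `δ⁻¹` is also integral over `k`, hence lies in `A`; therefore `B ⊆ A[θ] ⊆ C`.
  have hBC : ∀ b : B, ((b : E) : M) ∈ C := by
    intro b
    let P := IntermediateField.adjoin.powerBasis hθF
    have hP : IsIntegral k P.gen := by
      rw [← isIntegral_algHom_iff (E.val.restrictScalars k) E.val.injective]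
      exact hθ
    have h1 := Algebra.discr_mul_isIntegral_mem_adjoin F (B := P) (hP.tower_top (A := A)) b.2
    set δ := Algebra.discr F P.basis with hδ
    have hδ0 : δ ≠ 0 := Algebra.discr_not_zero_of_basis F P.basis
    have hδk : IsIntegral k δ := Algebra.discr_isIntegral F fun i => by
      rw [P.basis_eq_pow]
      exact hP.pow _
    obtain ⟨ε, hε⟩ := IsIntegrallyClosed.isIntegral_iff.mp (hδk.inv.tower_top (A := A))
    have h2 : Algebra.adjoin A {P.gen} ≤ C.comap (IsScalarTower.toAlgHom A E M) :=
      Algebra.adjoin_le (Set.singleton_subset_iff.mpr hθC)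
    have h3 := h2 ((Algebra.adjoin A {P.gen}).smul_mem h1 ε)
    rwa [← algebraMap_smul F ε, hε, smul_smul, inv_mul_cancel₀ hδ0, one_smul] at h3
  let φ : B →+* C :=
    { toFun b := ⟨b, hBC b⟩, map_one' := rfl, map_mul' _ _ := rfl, map_zero' := rfl,
      map_add' _ _ := rfl }
  algebraize [φ]
  have : IsScalarTower A B C := .of_algebraMap_eq fun a => rfl
  have : Algebra.IsIntegral B C := .tower_top (R := A)
  have hφ : Function.Injective (algebraMap B C) := fun x y h =>
    Subtype.ext (Subtype.ext (congr_arg (fun c : C => (c : M)) h))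
  -- Lying over for the integral extension `B ⊆ C` carries the pole to a prime of `C`.
  obtain ⟨Q, -, hQ, hQv⟩ := Ideal.exists_ideal_over_prime_of_isIntegral v.asIdeal (⊥ : Ideal C)
    ((Ideal.comap_bot_of_injective _ hφ).trans_le bot_le)
  refine ⟨Q, hQ, ?_, φ n, ?_, φ d, fun h => d.2 (hQv.le h), ?_⟩
  · rw [IsScalarTower.algebraMap_eq A B C, ← Ideal.comap_comap, hQv]
    refine IsLocalRing.eq_maximalIdeal ?_
    exact Ideal.isMaximal_comap_of_isIntegral_of_isMaximal (hI := v.isMaximal) v.asIdeal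
  · rw [← hQv] at hn
    exact hn
  · have := congr_arg (algebraMap E M) hnd
    rw [map_mul, map_inv₀, inv_mul_eq_iff_eq_mul₀ ((map_ne_zero _).mpr hw0)] at this
    exact this.symm

/-! ### Descending hyperplanes from `K` to `k`. -/

/-- In a normal algebraic extension, an element fixed by all automorphisms is purely inseparable
over the base field. -/
theorem exists_pow_mem_range_of_fixed {k K : Type*} [Field k] [Field K] [Algebra k K]
    [IsAlgClosed K] [Algebra.IsAlgebraic k K] (q : ℕ) [ExpChar k q] {a : K}
    (ha : ∀ σ : K ≃ₐ[k] K, σ a = a) : ∃ n : ℕ, a ^ q ^ n ∈ (algebraMap k K).range := by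
  classical
  have hint : IsIntegral k a := Algebra.IsIntegral.isIntegral a
  have : IsAlgClosure k K := ⟨inferInstance, inferInstance⟩
  have : Normal k K := IsAlgClosure.normal k K
  rw [← minpoly.natSepDegree_eq_one_iff_pow_mem q, Polynomial.natSepDegree_eq_of_splits (E := K) _
    (IsAlgClosed.splits _), Finset.card_eq_one]
  refine ⟨a, Finset.eq_singleton_iff_unique_mem.mpr ⟨?_, fun b hb => ?_⟩⟩
  · simp [minpoly.ne_zero hint]
  · rw [Multiset.mem_toFinset, Polynomial.mem_aroots] at hb
    obtain ⟨σ, rfl⟩ := minpoly.exists_algEquiv_of_root' hint.isAlgebraic hb.2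
    exact ha σ

/-- A hyperplane defined over the algebraic closure of `k`, together with its conjugates, is the
zero set of a form over `k`. -/
theorem exists_isHomogeneous_aeval_eq_prod_pow {k K ι : Type*} [Field k] [Field K] [Algebra k K]
    [IsAlgClosed K] [Algebra.IsAlgebraic k K] [Fintype ι] {c : ι → K} (hc : c ≠ 0) :
    ∃ T : Finset (ι → K), (∀ t ∈ T, t ≠ 0) ∧ c ∈ T ∧ ∃ m > 0, ∃ (d : ℕ) (P : MvPolynomial ι k),
      P.IsHomogeneous d ∧ ∀ x : ι → K, MvPolynomial.aeval x P = (∏ t ∈ T, ∑ i, t i * x i) ^ m := by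
  classical
  let q := ringExpChar k
  have hfin : (Set.range fun σ : K ≃ₐ[k] K => fun i => σ (c i)).Finite := by
    refine (Set.Finite.pi' fun i => (minpoly k (c i)).rootSet_finite K).subset ?_
    rintro _ ⟨σ, rfl⟩ i
    rw [Polynomial.mem_rootSet]
    exact ⟨minpoly.ne_zero (Algebra.IsIntegral.isIntegral _), by
      rw [Polynomial.aeval_algEquiv]; simp⟩
  let T := hfin.toFinset
  have hT : ∀ t, t ∈ T ↔ ∃ σ : K ≃ₐ[k] K, (fun i => σ (c i)) = t := fun t => by simp [T]
  -- The product over the finite orbit `T` of `c` is invariant under automorphisms, so its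
  -- coefficients are purely inseparable over `k` and a `q ^ n`-th power of it is defined over `k`.
  let Q : MvPolynomial ι K := ∏ t ∈ T, ∑ i, MvPolynomial.C (t i) * MvPolynomial.X i
  have hQ : ∀ σ : K ≃ₐ[k] K, MvPolynomial.map (σ : K →+* K) Q = Q := by
    intro σ
    simp only [Q, map_prod, map_sum, map_mul, MvPolynomial.map_C, MvPolynomial.map_X]
    refine Finset.prod_bij (fun t _ i => σ (t i)) (fun t ht => ?_) (fun t _ t' _ h => ?_)
      (fun t ht => ?_) (fun t _ => rfl)
    · obtain ⟨τ, rfl⟩ := (hT t).mp ht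
      exact (hT _).mpr ⟨τ.trans σ, rfl⟩
    · funext i
      exact σ.injective (congr_fun h i)
    · obtain ⟨τ, rfl⟩ := (hT t).mp ht
      exact ⟨fun i => (τ.trans σ.symm) (c i), (hT _).mpr ⟨_, rfl⟩, by simp⟩
  let : Algebra (MvPolynomial ι k) (MvPolynomial ι K) :=
    (MvPolynomial.map (algebraMap k K)).toAlgebra
  have : ExpChar (MvPolynomial ι K) q := expChar_of_injective_algebraMap (R := k)
    (algebraMap k (MvPolynomial ι K)).injective q
  have hQp : Q ∈ Subalgebra.perfectClosure (MvPolynomial ι k) (MvPolynomial ι K) q := by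
    rw [Q.as_sum]
    refine sum_mem fun s _ => ?_
    rw [MvPolynomial.monomial_eq]
    refine mul_mem ?_ (prod_mem fun i _ => pow_mem ?_ _)
    · obtain ⟨n, a, ha⟩ := exists_pow_mem_range_of_fixed (k := k) q (a := Q.coeff s) fun σ => by
        conv_rhs => rw [← hQ σ, MvPolynomial.coeff_map]
        rfl
      exact Subalgebra.mem_perfectClosure_iff.mpr ⟨n, MvPolynomial.C a, by
        rw [RingHom.algebraMap_toAlgebra, MvPolynomial.map_C, ha, map_pow]⟩
    · convert Subalgebra.algebraMap_mem _ (MvPolynomial.X i : MvPolynomial ι k)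
      exact (MvPolynomial.map_X _ i).symm
  obtain ⟨n, P, hP⟩ := Subalgebra.mem_perfectClosure_iff.mp hQp
  refine ⟨T, fun t ht h0 => ?_, (hT _).mpr ⟨.refl, rfl⟩, q ^ n, pow_pos (expChar_pos k q) _,
    T.card * q ^ n, P, ?_, fun x => ?_⟩
  · obtain ⟨σ, rfl⟩ := (hT t).mp ht
    exact hc (funext fun i => by simpa using congr_fun h0 i)
  · refine MvPolynomial.IsHomogeneous.of_map (algebraMap k K).injective ?_
    have h1 : Q.IsHomogeneous T.card := by
      have := MvPolynomial.IsHomogeneous.prod T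
        (fun t => ∑ i, MvPolynomial.C (t i) * MvPolynomial.X i) (fun _ => 1) fun t _ =>
          MvPolynomial.IsHomogeneous.sum _ _ 1 fun i _ =>
            MvPolynomial.isHomogeneous_C_mul_X (t i) i
      simpa using this
    have := h1.pow (q ^ n)
    rw [← hP] at this
    exact this
  · have := congr_arg (MvPolynomial.aeval x) hP
    rw [map_pow, RingHom.algebraMap_toAlgebra, MvPolynomial.aeval_map_algebraMap] at this
    rw [this]
    simp [Q]

theorem exists_apply_eq_sum {K ι : Type*} [CommRing K] [Fintype ι] (ℓ : (ι → K) →ₗ[K] K) :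
    ∃ c : ι → K, ∀ x, ℓ x = ∑ i, c i * x i := by
  classical
  refine ⟨fun i => ℓ (Pi.single i 1), fun x => ?_⟩
  conv_lhs => rw [← Finset.univ_sum_single x, map_sum]
  refine Finset.sum_congr rfl fun i _ => ?_
  rw [mul_comm, ← smul_eq_mul, ← map_smul, ← Pi.single_smul, smul_eq_mul, mul_one]

/-! ### Dense open subsets of `W` avoiding hyperplanes. -/

namespace WeilLinearSystem

section Projective

variable {k : Type u} [Field k] {K : Type u} [Field K] [Algebra k K] {n : ℕ}

/-- A form over `k` is a form over `K`. In the order on topologies, `≤` means finer. -/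
theorem zariski_le : zariski K K n ≤ zariski k K n := by
  refine le_generateFrom ?_
  rintro _ ⟨d, F, hF, rfl⟩
  refine TopologicalSpace.isOpen_generateFrom_of_mem
    ⟨d, MvPolynomial.map (algebraMap k K) F, hF.map _, ?_⟩
  ext v
  simp [MvPolynomial.aeval_map_algebraMap]

theorem isOpen_ne_zero (c : Fin (n + 1) → K) :
    @IsOpen _ (zariski K K n) {v | ∑ i, c i * v.rep i ≠ 0} :=
  TopologicalSpace.isOpen_generateFrom_of_mem
    ⟨1, ∑ i, MvPolynomial.C (c i) * MvPolynomial.X i, MvPolynomial.IsHomogeneous.sum _ _ 1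
      fun i _ => MvPolynomial.isHomogeneous_C_mul_X (c i) i, by simp⟩

theorem exists_mem_of_span_eq_top {W : Set (ℙ K (Fin (n + 1) → K))}
    (hspan : Projectivization.Subspace.span W = ⊤) {c : Fin (n + 1) → K} (hc : c ≠ 0) :
    ∃ v ∈ W, ∑ i, c i * v.rep i ≠ 0 := by
  by_contra! h
  let H : Submodule K (Fin (n + 1) → K) := LinearMap.ker (Fintype.linearCombination K c)
  have hH : W ⊆ H.projectivization := by
    intro v hv
    rw [← v.mk_rep]
    refine (Submodule.mk_mem_projectivization_iff H v.rep_nonzero).mpr ?_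
    simpa [H, Fintype.linearCombination_apply, mul_comm] using h v hv
  rw [← Projectivization.Subspace.span_le_subspace_iff, hspan, top_le_iff] at hH
  have hH' : H = ⊤ := by simpa using hH
  apply hc
  funext i
  have : Pi.single i 1 ∈ H := hH' ▸ trivial
  simpa [H, Fintype.linearCombination_apply, Pi.single_apply] using this

/-- A geometrically irreducible subvariety spanning projective space contains a dense open
subset, defined over the ground field, which avoids given hyperplanes, and still spans. -/
theorem exists_isDenseOpenIn [IsAlgClosure k K] {W : Set (ℙ K (Fin (n + 1) → K))}
    (hW : IsGeomIrreducibleSubvariety k W) (hspan : Projectivization.Subspace.span W = ⊤)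
    (T : Finset (Fin (n + 1) → K)) (hT : ∀ c ∈ T, c ≠ 0) :
    ∃ W₀, IsDenseOpenIn k W₀ W ∧ (∀ v ∈ W₀, ∀ c ∈ T, ∑ i, c i * v.rep i ≠ 0) ∧
      Submodule.span K (Projectivization.rep '' W₀) = ⊤ := by
  classical
  have : IsAlgClosed K := IsAlgClosure.isAlgClosed k
  have : Algebra.IsAlgebraic k K := IsAlgClosure.isAlgebraic
  have hW2 := hW.isIrreducible.2
  -- By irreducibility, finitely many open sets that each meet `W` meet it in a common point; each
  -- hyperplane complement meets `W` because `W` spans.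
  have key : ∀ (S : Finset (Fin (n + 1) → K)), (∀ c ∈ S, c ≠ 0) →
      @IsOpen _ (zariski K K n) {v | ∀ c ∈ S, ∑ i, c i * v.rep i ≠ 0} ∧
      (W ∩ {v | ∀ c ∈ S, ∑ i, c i * v.rep i ≠ 0}).Nonempty := by
    intro S hS
    induction S using Finset.induction_on with
    | empty => simpa using hW.isIrreducible.1
    | insert c S _ ih =>
      obtain ⟨h1, h2⟩ := ih fun c hc => hS c (Finset.mem_insert_of_mem hc)
      have h3 : {v : ℙ K (Fin (n + 1) → K) | ∀ t ∈ insert c S, ∑ i, t i * v.rep i ≠ 0} =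
        {v | ∑ i, c i * v.rep i ≠ 0} ∩ {v | ∀ c ∈ S, ∑ i, c i * v.rep i ≠ 0} := by ext; simp
      rw [h3]
      refine ⟨@IsOpen.inter _ (zariski K K n) _ _ (isOpen_ne_zero c) h1,
        hW2 _ _ (isOpen_ne_zero c) h1 ?_ h2⟩
      exact exists_mem_of_span_eq_top hspan (hS c (Finset.mem_insert_self _ _))
  -- `N c` is the set of conjugates of `c`, and `P c` the form over `k` cutting out the union of
  -- their hyperplanes. Avoiding all conjugates, not just `c`, is what makes `G` open over `k`.
  choose! N hN hcN m hm d P hP hPN using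
    fun c : Fin (n + 1) → K => exists_isHomogeneous_aeval_eq_prod_pow (k := k) (c := c)
  let G : Set (ℙ K (Fin (n + 1) → K)) :=
    ⋂ c ∈ T, {v | MvPolynomial.aeval v.rep (P c) ≠ 0}
  have hG : G = {v | ∀ c ∈ T.biUnion N, ∑ i, c i * v.rep i ≠ 0} := by
    ext v
    simp only [G, Set.mem_iInter, Set.mem_ofPred_eq, Finset.mem_biUnion]
    refine ⟨?_, fun h c hc => ?_⟩
    · rintro h t ⟨c, hc, ht⟩
      have := h c hc
      rw [hPN c (hT c hc)] at this
      exact Finset.prod_ne_zero_iff.mp ((pow_ne_zero_iff (hm c (hT c hc)).ne').mp this) t ht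
    · rw [hPN c (hT c hc)]
      exact pow_ne_zero _ (Finset.prod_ne_zero_iff.mpr fun t ht => h t ⟨c, hc, ht⟩)
  have hNT : ∀ c ∈ T.biUnion N, c ≠ 0 := by
    intro t ht
    obtain ⟨c, hc, ht⟩ := Finset.mem_biUnion.mp ht
    exact hN c (hT c hc) t ht
  obtain ⟨hGo, hGW⟩ := key _ hNT
  rw [← hG] at hGo hGW
  have hGk : @IsOpen _ (zariski k K n) G := by
    let := zariski k K n
    exact isOpen_biInter_finset fun c hc => TopologicalSpace.isOpen_generateFrom_of_mem
      ⟨d c, P c, hP c (hT c hc), rfl⟩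
  refine ⟨G ∩ W, ⟨⟨G, hGk, rfl⟩, ?_⟩, fun v hv c hc => ?_, ?_⟩
  · intro w hw
    rw [@mem_closure_iff _ (zariski k K n)]
    intro O hO hwO
    rw [Set.inter_comm G W, Set.inter_comm, Set.inter_assoc, Set.inter_comm G O]
    exact hW2 _ _ (zariski_le _ hO) hGo ⟨w, hw, hwO⟩ hGW
  · rw [hG] at hv
    exact hv.1 c (Finset.mem_biUnion.mpr ⟨c, hc, hcN c (hT c hc)⟩)
  · by_contra hne
    -- If `G ∩ W` lay in a hyperplane, then `G` and the complement of that hyperplane, both of which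
    -- meet `W`, would contradict irreducibility.
    obtain ⟨ℓ, hℓ, hle⟩ := Submodule.exists_le_ker_of_lt_top _ (lt_top_iff_ne_top.mpr hne)
    obtain ⟨c, hℓc⟩ := exists_apply_eq_sum ℓ
    have hc : c ≠ 0 := fun h0 => hℓ (LinearMap.ext fun x => by simp [hℓc, h0])
    obtain ⟨v, hv, hvG, hvc⟩ := hW2 _ _ hGo (isOpen_ne_zero c) hGW
      (exists_mem_of_span_eq_top hspan hc)
    exact hvc (by rw [← hℓc]; exact hle (Submodule.subset_span ⟨v, ⟨hvG, hv⟩, rfl⟩))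

end Projective

end WeilLinearSystem

/-! ### Orders of vanishing and their behaviour under pull-back. -/

theorem Ring.ord_ringEquiv {R S : Type*} [CommRing R] [CommRing S] (e : R ≃+* S) (a : R) :
    Ring.ord S (e a) = Ring.ord R a := by
  algebraize [e.toRingHom]
  have hs : Function.Surjective (algebraMap R S) := e.surjective
  unfold Ring.ord
  rw [← Module.length_eq_of_surjective (M := S ⧸ Ideal.span {e a}) hs]
  refine (LinearEquiv.length_eq (Submodule.Quotient.equiv (Ideal.span {a})
    ((Ideal.span {e a}).restrictScalars R) { e with map_smul' := fun r x => ?_ } ?_)).symm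
  · simp [Algebra.smul_def]; rfl
  · ext y
    constructor
    · rintro ⟨x, hx, rfl⟩
      obtain ⟨b, rfl⟩ := Ideal.mem_span_singleton'.mp hx
      exact Ideal.mem_span_singleton'.mpr ⟨e b, (map_mul e b a).symm⟩
    · intro hy
      obtain ⟨b, rfl⟩ := Ideal.mem_span_singleton'.mp hy
      exact ⟨e.symm b * a, Ideal.mem_span_singleton'.mpr ⟨_, rfl⟩, by
        simp [map_mul e]⟩

namespace WeilLinearSystem

section Order

variable {X Y Z : Scheme.{u}} [IsIntegral X] [IsIntegral Y] [IsIntegral Z]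

theorem exists_div_of_ne_zero (x : X) {f : X.functionField} (hf : f ≠ 0) :
    ∃ a b : X.presheaf.stalk x, a ≠ 0 ∧ b ≠ 0 ∧
      f = algebraMap _ X.functionField a / algebraMap _ X.functionField b := by
  obtain ⟨a, b, hb, rfl⟩ := IsFractionRing.div_surjective (A := X.presheaf.stalk x) f
  exact ⟨a, b, by rintro rfl; simp at hf, nonZeroDivisors.ne_zero hb, rfl⟩

section

variable [IsLocallyNoetherian X]

theorem ord_algebraMap {x : X} (hx : coheight x = 1) {a : X.presheaf.stalk x} (ha : a ≠ 0) :
    X.ord (algebraMap _ X.functionField a) x = ((Ring.ord (X.presheaf.stalk x) a).toNat : ℤ) := by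
  have : Ring.KrullDimLE 1 (X.presheaf.stalk x) := krullDimLE_of_coheight_le hx.le
  have hn : Ring.ord (X.presheaf.stalk x) a ≠ ⊤ :=
    Ring.ord_ne_top (mem_nonZeroDivisors_of_ne_zero ha)
  rw [Scheme.ord_eq_iff hx (by simpa using ha)]
  refine (Ring.ordFrac_eq_ord _ ha).trans ?_
  exact Ring.ordMonoidWithZeroHom_eq_coe _ (mem_nonZeroDivisors_of_ne_zero ha)
    (ENat.natCast_toNat hn).symm

theorem ord_algebraMap_of_isUnit {x : X} (hx : coheight x = 1) {a : X.presheaf.stalk x}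
    (ha : IsUnit a) : X.ord (algebraMap _ X.functionField a) x = 0 := by
  rw [ord_algebraMap hx ha.ne_zero, Ring.ord_of_isUnit ha]
  rfl

theorem ord_algebraMap_pos {x : X} (hx : coheight x = 1) {a : X.presheaf.stalk x}
    (ha : a ≠ 0) (hu : ¬ IsUnit a) : 0 < X.ord (algebraMap _ X.functionField a) x := by
  have : Ring.KrullDimLE 1 (X.presheaf.stalk x) := krullDimLE_of_coheight_le hx.le
  have hn : Ring.ord (X.presheaf.stalk x) a ≠ ⊤ :=
    Ring.ord_ne_top (mem_nonZeroDivisors_of_ne_zero ha)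
  rw [ord_algebraMap hx ha, Nat.cast_pos, Nat.pos_iff_ne_zero, Ne, ENat.toNat_eq_zero]
  rintro (h | h)
  · rw [Ring.ord, Module.length_eq_zero_iff, Ideal.Quotient.subsingleton_iff,
      Ideal.span_singleton_eq_top] at h
    exact hu h
  · exact hn h

theorem ord_inv (f : X.functionField) (x : X) : X.ord f⁻¹ x = - X.ord f x := by
  by_cases hf : f = 0
  · simp [hf]
  · have h := Scheme.ord_mul (x := x) hf (inv_ne_zero hf)
    have h1 := Scheme.ord_mul (x := x) (one_ne_zero (α := X.functionField)) one_ne_zero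
    rw [mul_inv_cancel₀ hf] at h
    rw [mul_one] at h1
    linarith

theorem ord_one (x : X) : X.ord (1 : X.functionField) x = 0 := by
  have h1 := Scheme.ord_mul (x := x) (one_ne_zero (α := X.functionField)) one_ne_zero
  rw [mul_one] at h1
  linarith

theorem ord_pow {f : X.functionField} (hf : f ≠ 0) (n : ℕ) (x : X) :
    X.ord (f ^ n) x = n * X.ord f x := by
  induction n with
  | zero => simp [ord_one]
  | succ n ih =>
    rw [pow_succ, Scheme.ord_mul (pow_ne_zero n hf) hf, ih]
    push_cast
    ring

theorem ord_div {f g : X.functionField} (hf : f ≠ 0) (hg : g ≠ 0) (x : X) :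
    X.ord (f / g) x = X.ord f x - X.ord g x := by
  rw [div_eq_mul_inv, Scheme.ord_mul hf (inv_ne_zero hg), ord_inv, sub_eq_add_neg]

/-- The order of a rational function depends only on the local ring as a subring of the
function field. -/
theorem ord_eq_ord_of_range_eq [IsLocallyNoetherian Y] (e : X.functionField ≃+* Y.functionField)
    {x : X} {y : Y} (hx : coheight x = 1) (hy : coheight y = 1)
    (h : (algebraMap (X.presheaf.stalk x) X.functionField).range.map e.toRingHom =
      (algebraMap (Y.presheaf.stalk y) Y.functionField).range) (f : X.functionField) :
    Y.ord (e f) y = X.ord f x := by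
  by_cases hf : f = 0
  · simp [hf]
  let r := fun {W : Scheme.{u}} [IsIntegral W] (w : W) => RingEquiv.ofBijective
    (algebraMap (W.presheaf.stalk w) W.functionField).rangeRestrict
    ⟨fun a b hab => IsFractionRing.injective _ W.functionField (congr_arg Subtype.val hab),
      RingHom.rangeRestrict_surjective _⟩
  let φ : X.presheaf.stalk x ≃+* Y.presheaf.stalk y :=
    (r x).trans ((RingEquiv.subringMap (s := (algebraMap (X.presheaf.stalk x) X.functionField).range) e).trans
      ((RingEquiv.subringCongr h).trans (r y).symm))
  have hφ : ∀ a, algebraMap _ Y.functionField (φ a) = e (algebraMap _ X.functionField a) := by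
    intro a
    exact congr_arg Subtype.val ((r y).apply_symm_apply _)
  have key : ∀ a : X.presheaf.stalk x, a ≠ 0 → Y.ord (e (algebraMap _ X.functionField a)) y =
      X.ord (algebraMap _ X.functionField a) x := by
    intro a ha
    rw [← hφ, ord_algebraMap hy (by simpa using ha), ord_algebraMap hx ha, Ring.ord_ringEquiv]
  obtain ⟨a, b, ha, hb, rfl⟩ := exists_div_of_ne_zero x hf
  rw [map_div₀, ord_div, ord_div, key a ha, key b hb] <;> simpa

end

theorem functionFieldMap_algebraMap (p : Z ⟶ X) [IsDominant p] (z : Z)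
    (a : X.presheaf.stalk (p z)) :
    functionFieldMap p (algebraMap _ X.functionField a) =
      algebraMap _ Z.functionField (p.stalkMap z a) := by
  have : X.presheaf.stalkSpecializes ((genericPoint_spec X).specializes trivial) ≫
      functionFieldMap p = p.stalkMap z ≫
        Z.presheaf.stalkSpecializes ((genericPoint_spec Z).specializes trivial) := by
    unfold functionFieldMap
    rw [← Scheme.Hom.stalkSpecializes_stalkMap, TopCat.Presheaf.stalkSpecializes_comp_assoc]
  exact congr($(this) a)

theorem functionFieldMap_ne_zero (p : Z ⟶ X) [IsDominant p] {f : X.functionField} (hf : f ≠ 0) :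
    functionFieldMap p f ≠ 0 := (map_ne_zero (functionFieldMap p).hom).mpr hf

/-- The order of a pulled back function is the order of the function times the ramification
length. -/
theorem ord_functionFieldMap [IsLocallyNoetherian X] [IsLocallyNoetherian Z] [IsNormalScheme X]
    (p : Z ⟶ X) [IsDominant p] {z : Z} (hz : coheight z = 1) (hx : coheight (p z) = 1)
    {f : X.functionField} (hf : f ≠ 0) :
    Z.ord (functionFieldMap p f) z = X.ord f (p z) *
      ((Module.length (Z.presheaf.stalk z) (Z.presheaf.stalk z ⧸
      (IsLocalRing.maximalIdeal (X.presheaf.stalk (p z))).map (p.stalkMap z).hom)).toNat : ℤ) := by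
  have := isDiscreteValuationRing_stalk hx
  obtain ⟨π, hπ⟩ := IsDiscreteValuationRing.exists_irreducible (X.presheaf.stalk (p z))
  have hinj : Function.Injective (p.stalkMap z) := by
    intro a b hab
    have := congr_arg (algebraMap _ Z.functionField) hab
    rw [← functionFieldMap_algebraMap, ← functionFieldMap_algebraMap] at this
    exact IsFractionRing.injective _ X.functionField ((functionFieldMap p).hom.injective this)
  have hne : ∀ a, a ≠ 0 → p.stalkMap z a ≠ 0 := fun a ha =>
    (map_ne_zero_iff _ hinj).mpr ha
  have key : ∀ a : X.presheaf.stalk (p z), a ≠ 0 →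
      Z.ord (functionFieldMap p (algebraMap _ X.functionField a)) z =
      X.ord (algebraMap _ X.functionField a) (p z) *
      ((Module.length (Z.presheaf.stalk z) (Z.presheaf.stalk z ⧸
      (IsLocalRing.maximalIdeal (X.presheaf.stalk (p z))).map (p.stalkMap z).hom)).toNat : ℤ) := by
    intro a ha
    -- Only the local ring of `X` is assumed normal. Upstairs the order of `π` is by definition the
    -- length of the quotient by `π`, which generates the extended maximal ideal.
    obtain ⟨m, u, rfl⟩ := IsDiscreteValuationRing.eq_unit_mul_pow_irreducible ha hπ
    have h0 := hπ.ne_zero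
    have hu : algebraMap (X.presheaf.stalk (p z)) X.functionField u ≠ 0 := by simp
    have hp : algebraMap (X.presheaf.stalk (p z)) X.functionField π ≠ 0 := by simpa
    rw [map_mul, map_mul, map_pow, map_pow, Scheme.ord_mul (functionFieldMap_ne_zero p hu)
      (pow_ne_zero _ (functionFieldMap_ne_zero p hp)), ord_pow (functionFieldMap_ne_zero p hp),
      Scheme.ord_mul hu (pow_ne_zero _ hp), ord_pow hp, ord_algebraMap_of_isUnit hx u.isUnit,
      functionFieldMap_algebraMap, ord_algebraMap_of_isUnit hz (u.isUnit.map (p.stalkMap z).hom),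
      functionFieldMap_algebraMap, ord_algebraMap hz (hne _ h0), ord_algebraMap hx h0,
      Ring.ord_of_irreducible hπ, Ring.ord, hπ.maximalIdeal_eq, Ideal.map_span,
      Set.image_singleton]
    simp
  obtain ⟨a, b, ha, hb, rfl⟩ := exists_div_of_ne_zero (p z) hf
  have ha' : algebraMap (X.presheaf.stalk (p z)) X.functionField a ≠ 0 := by simpa
  have hb' : algebraMap (X.presheaf.stalk (p z)) X.functionField b ≠ 0 := by simpa
  rw [map_div₀, ord_div (functionFieldMap_ne_zero p ha') (functionFieldMap_ne_zero p hb'),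
    ord_div ha' hb', key a ha, key b hb, sub_mul]

end Order

end WeilLinearSystem

/-! ### Generators of pushouts; codimension under flat integral morphisms. -/

/-- Both maps factor through the subring they generate, so the universal property gives a section of
its inclusion into `D`. -/
theorem CommRingCat.closure_range_union_range_of_isPushout {A B C D : CommRingCat.{u}} {f : A ⟶ B}
    {g : A ⟶ C} {i : B ⟶ D} {j : C ⟶ D} (h : IsPushout f g i j) :
    Subring.closure (Set.range i ∪ Set.range j) = ⊤ := by
  let T := Subring.closure (Set.range i ∪ Set.range j)
  let i' : B ⟶ .of T := CommRingCat.ofHom (i.hom.codRestrict T fun b =>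
    Subring.subset_closure (.inl ⟨b, rfl⟩))
  let j' : C ⟶ .of T := CommRingCat.ofHom (j.hom.codRestrict T fun b =>
    Subring.subset_closure (.inr ⟨b, rfl⟩))
  have hij : f ≫ i' = g ≫ j' := by
    ext a
    exact ConcreteCategory.congr_hom h.w a
  have : h.desc i' j' hij ≫ CommRingCat.ofHom T.subtype = 𝟙 D := by
    refine h.hom_ext ?_ ?_
    · rw [h.inl_desc_assoc, Category.comp_id]; rfl
    · rw [h.inr_desc_assoc, Category.comp_id]; rfl
  refine eq_top_iff.mpr fun d _ => ?_
  have h2 : (h.desc i' j' hij d : D) = d := congr($this d)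
  rw [← h2]
  exact (h.desc i' j' hij d).2

namespace AlgebraicGeometry

/-- An integral morphism has no specializations in its fibres. -/
theorem IsIntegralHom.eq_of_specializes {X Y : Scheme.{u}} (f : X ⟶ Y) [IsIntegralHom f]
    {x x' : X} (h : x' ⤳ x) (hf : f x' = f x) : x' = x := by
  obtain ⟨_, ⟨V, hV, rfl⟩, hxV, -⟩ := Y.isBasis_affineOpens.exists_subset_of_mem_open
    (Set.mem_univ (f x)) isOpen_univ
  have hU : IsAffineOpen (f ⁻¹ᵁ V) := hV.preimage f
  have hx : x ∈ f ⁻¹ᵁ V := hxV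
  have hx' : x' ∈ f ⁻¹ᵁ V := by
    change f x' ∈ V
    rwa [hf]
  have e := hU.fromSpec_primeIdealOf ⟨x, hx⟩
  have e' := hU.fromSpec_primeIdealOf ⟨x', hx'⟩
  have h1 : hU.primeIdealOf ⟨x', hx'⟩ ⤳ hU.primeIdealOf ⟨x, hx⟩ := by
    refine hU.fromSpec.isOpenEmbedding.isInducing.specializes_iff.mp ?_
    rwa [e, e']
  have h2 := (PrimeSpectrum.le_iff_specializes _ _).mpr h1
  have h3 : (hU.primeIdealOf ⟨x', hx'⟩).comap (f.appLE V (f ⁻¹ᵁ V) le_rfl).hom =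
      (hU.primeIdealOf ⟨x, hx⟩).comap (f.appLE V (f ⁻¹ᵁ V) le_rfl).hom := by
    rw [IsAffineOpen.comap_primeIdealOf_appLE V hV _ hU le_rfl hx',
      IsAffineOpen.comap_primeIdealOf_appLE V hV _ hU le_rfl hx]
    congr 1
    exact Subtype.ext hf
  have h4 : (f.appLE V (f ⁻¹ᵁ V) le_rfl).hom.IsIntegral := by
    rw [Scheme.Hom.appLE_eq_app]
    exact f.isIntegral_app V hV
  have h5 : hU.primeIdealOf ⟨x', hx'⟩ = hU.primeIdealOf ⟨x, hx⟩ := by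
    by_contra hne
    algebraize [(f.appLE V (f ⁻¹ᵁ V) le_rfl).hom]
    have : Algebra.IsIntegral Γ(Y, V) Γ(X, f ⁻¹ᵁ V) := algebraMap_isIntegral_iff.mp h4
    exact (Ideal.IsIntegral.comap_lt_comap (R := Γ(Y, V)) (lt_of_le_of_ne h2 fun h =>
      hne (PrimeSpectrum.ext h))).ne (congr_arg PrimeSpectrum.asIdeal h3)
  exact (e'.symm.trans (congr_arg _ h5)).trans e

/-- Chains of generalizations stay strict in the image by incomparability, and lift by going down
for flat morphisms. -/
theorem IsIntegralHom.coheight_apply {X Y : Scheme.{u}} (f : X ⟶ Y) [IsIntegralHom f] [Flat f]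
    (x : X) : coheight (f x) = coheight x := by
  refine (coheight_eq_of_strictMono f (fun a b hab => ?_) (fun a b hab => ?_) x).symm
  · have h1 : b ⤳ a := Scheme.le_iff_specializes.mp hab.le
    refine ⟨Scheme.le_iff_specializes.mpr (h1.map f.continuous), fun h => hab.not_ge ?_⟩
    have h2 := (h1.map f.continuous).antisymm (Scheme.le_iff_specializes.mp h)
    rw [IsIntegralHom.eq_of_specializes f h1 h2.eq]
  · obtain ⟨a', ha', rfl⟩ := Flat.generalizingMap f (Scheme.le_iff_specializes.mp hab.le)
    refine ⟨a', ⟨Scheme.le_iff_specializes.mpr ha', fun h => hab.not_ge ?_⟩, rfl⟩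
    exact Scheme.le_iff_specializes.mpr ((Scheme.le_iff_specializes.mp h).map f.continuous)

end AlgebraicGeometry

/-! ### The function field and sections of `X_K`. -/

namespace WeilLinearSystem

section Germs

variable {k : Type u} [Field k] {X Y : Scheme.{u}} [IsIntegral X] [IsIntegral Y]

theorem germToFunctionField_appLE (s : X ⟶ Spec (.of k)) (V : X.Opens) [Nonempty V]
    (h : V ≤ s ⁻¹ᵁ ⊤) (e : Γ(Spec (.of k), ⊤)) :
    X.germToFunctionField V (s.appLE ⊤ V h e) =
      constants s ((Scheme.ΓSpecIso (.of k)).hom e) := by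
  have h3 : (Scheme.ΓSpecIso (.of k)).hom ≫ (Scheme.ΓSpecIso (.of k)).inv ≫
      s.appTop ≫ X.presheaf.germ ⊤ (genericPoint _) trivial =
      s.appLE ⊤ V h ≫ X.germToFunctionField V := by
    rw [Iso.hom_inv_id_assoc]
    delta Scheme.Hom.appLE
    rw [Category.assoc]
    erw [TopCat.Presheaf.germ_res]
    rfl
  exact congr($h3 e).symm

theorem germToFunctionField_appLE_eq_functionFieldMap (f : Y ⟶ X) [IsDominant f] (V : X.Opens) [Nonempty V]
    [Nonempty (f ⁻¹ᵁ V)] (a : Γ(X, V)) :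
    Y.germToFunctionField (f ⁻¹ᵁ V) (f.appLE V (f ⁻¹ᵁ V) le_rfl a) =
      functionFieldMap f (X.germToFunctionField V a) := by
  rw [Scheme.Hom.appLE_eq_app]
  exact congr($(germ_functionFieldMap f V
    (((genericPoint_spec X).mem_open_set_iff V.isOpen).mpr (by simpa using ‹Nonempty V›))) a).symm

end Germs

section BaseChangeField

variable {k : Type u} [Field k] {X : Scheme.{u}} (s : X ⟶ Spec (.of k)) (K : Type u) [Field K]
  [Algebra k K]

theorem BaseChange.isPullback : IsPullback (BaseChange.proj s K) (BaseChange.str s K) s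
    (Spec.map (CommRingCat.ofHom (algebraMap k K))) := IsPullback.of_hasPullback _ _

instance : Flat (BaseChange.proj s K) := by
  have : Flat (Spec.map (CommRingCat.ofHom (algebraMap k K))) := by
    rw [Flat.SpecMap_iff]
    exact RingHom.flat_algebraMap_iff.mpr inferInstance
  exact inferInstanceAs (Flat (pullback.fst s (Spec.map (CommRingCat.ofHom (algebraMap k K)))))

instance [Algebra.IsAlgebraic k K] : IsIntegralHom (BaseChange.proj s K) := by
  have : IsIntegralHom (Spec.map (CommRingCat.ofHom (algebraMap k K))) := by
    rw [IsIntegralHom.SpecMap_iff]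
    exact algebraMap_isIntegral_iff.mpr inferInstance
  exact inferInstanceAs
    (IsIntegralHom (pullback.fst s (Spec.map (CommRingCat.ofHom (algebraMap k K)))))

theorem BaseChange.coheight_proj [Algebra.IsAlgebraic k K] (z : BaseChange s K) :
    coheight (BaseChange.proj s K z) = coheight z :=
  IsIntegralHom.coheight_apply _ z

variable [IsIntegral X] [IsIntegral (BaseChange s K)]

theorem functionFieldMap_proj_constants (c : k) :
    functionFieldMap (BaseChange.proj s K) (constants s c) =
      constants (BaseChange.str s K) (algebraMap k K c) := by
  rw [functionFieldMap_constants]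
  have h : (Scheme.ΓSpecIso (.of k)).inv ≫ (BaseChange.proj s K ≫ s).appTop =
      CommRingCat.ofHom (algebraMap k K) ≫ (Scheme.ΓSpecIso (.of K)).inv ≫
        (BaseChange.str s K).appTop := by
    rw [(BaseChange.isPullback s K).w, Scheme.Hom.comp_appTop, Scheme.ΓSpecIso_inv_naturality_assoc]
  have h2 := congr($h ≫ (BaseChange s K).presheaf.germ ⊤ (genericPoint _) trivial)
  exact congr($h2 c)

/-- Over an affine open `V`, the sections of `X_K` are the pushout of `Γ(X, V)` and `K` over `k`. -/
theorem germToFunctionField_mem_closure {V : X.Opens} (hV : IsAffineOpen V) [Nonempty V]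
    [Nonempty (BaseChange.proj s K ⁻¹ᵁ V)] (a : Γ(BaseChange s K, BaseChange.proj s K ⁻¹ᵁ V)) :
    (BaseChange s K).germToFunctionField _ a ∈ Subring.closure
      (Set.range (fun r : Γ(X, V) => functionFieldMap (BaseChange.proj s K)
        (X.germToFunctionField V r)) ∪ Set.range (constants (BaseChange.str s K))) := by
  have h := (isIso_pushoutSection_iff (BaseChange.isPullback s K) (US := ⊤) (UT := ⊤) (UX := V)
    (UY := BaseChange.proj s K ⁻¹ᵁ V) le_top le_top (by simp)).mp
    (isIso_pushoutSection_of_isAffineOpen (BaseChange.isPullback s K) _ _ _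
      (isAffineOpen_top _) (isAffineOpen_top _) hV)
  have ha : a ∈ Subring.closure _ :=
    (CommRingCat.closure_range_union_range_of_isPushout h).ge trivial
  have h2 := Subring.mem_map (f :=
    ((BaseChange s K).germToFunctionField (BaseChange.proj s K ⁻¹ᵁ V)).hom).mpr ⟨a, ha, rfl⟩
  rw [RingHom.map_closure] at h2
  refine Subring.closure_mono ?_ h2
  rintro _ ⟨_, ⟨r, rfl⟩ | ⟨c, rfl⟩, rfl⟩
  · left
    exact ⟨r, (germToFunctionField_appLE_eq_functionFieldMap (BaseChange.proj s K) V r).symm⟩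
  · right
    exact ⟨_, (germToFunctionField_appLE (BaseChange.str s K) _ _ c).symm⟩

end BaseChangeField

end WeilLinearSystem

/-! ### Hartogs on normal schemes and global functions. -/

namespace WeilLinearSystem

section Hartogs

variable {X : Scheme.{u}} [IsIntegral X]

theorem isIntegrallyClosed_section [IsNormalScheme X] {V : X.Opens} (hV : IsAffineOpen V)
    [Nonempty V] : IsIntegrallyClosed Γ(X, V) := by
  refine .of_localization_maximal fun p _ hp => ?_
  have hpV : hV.fromSpec ⟨p, hp.isPrime⟩ ∈ V := by
    have := Set.mem_range_self (f := hV.fromSpec) ⟨p, hp.isPrime⟩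
    rwa [hV.range_fromSpec] at this
  let := X.presheaf.algebra_section_stalk ⟨_, hpV⟩
  have : IsLocalization.AtPrime (X.presheaf.stalk (hV.fromSpec ⟨p, hp.isPrime⟩)) p :=
    hV.isLocalization_stalk' ⟨p, hp.isPrime⟩ hpV
  have := IsNormalScheme.isIntegrallyClosed_stalk (hV.fromSpec ⟨p, hp.isPrime⟩)
  exact .of_equiv (IsLocalization.algEquiv p.primeCompl
    (X.presheaf.stalk (hV.fromSpec ⟨p, hp.isPrime⟩)) (Localization.AtPrime p)).toRingEquiv

/-- Height-one primes of `Γ(X, V)` are the codimension one points in `V`, so the algebraic Hartogs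
statement applies on the chart. -/
theorem exists_section_eq [IsNormalScheme X] [IsLocallyNoetherian X] (f : X.functionField)
    (hf : ∀ x : X, coheight x = 1 → f ∈ (algebraMap (X.presheaf.stalk x) X.functionField).range)
    {V : X.Opens} (hV : IsAffineOpen V) [Nonempty V] :
    ∃ a : Γ(X, V), X.germToFunctionField V a = f := by
  have := isIntegrallyClosed_section hV
  have := functionField_isFractionRing_of_isAffineOpen X V hV
  have : IsNoetherianRing Γ(X, V) := IsLocallyNoetherian.component_noetherian ⟨V, hV⟩
  refine mem_range_algebraMap_of_forall_height_eq_one (R := Γ(X, V)) f fun p hp hp1 => ?_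
  have hpV : hV.fromSpec ⟨p, hp⟩ ∈ V := by
    have := Set.mem_range_self (f := hV.fromSpec) ⟨p, hp⟩
    rwa [hV.range_fromSpec] at this
  let := X.presheaf.algebra_section_stalk ⟨_, hpV⟩
  have hloc : IsLocalization.AtPrime (X.presheaf.stalk (hV.fromSpec ⟨p, hp⟩)) p :=
    hV.isLocalization_stalk' ⟨p, hp⟩ hpV
  obtain ⟨a, ha⟩ := hf (hV.fromSpec ⟨p, hp⟩) (by
    have h1 := ringKrullDim_stalk_eq_coheight (hV.fromSpec ⟨p, hp⟩)
    rw [IsLocalization.AtPrime.ringKrullDim_eq_height p, hp1] at h1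
    exact_mod_cast h1.symm)
  obtain ⟨⟨r, t⟩, hrt⟩ := IsLocalization.surj p.primeCompl a
  refine ⟨t, t.2, r, ?_⟩
  have := congr_arg (algebraMap _ X.functionField) hrt
  rw [map_mul, ha] at this
  rw [Algebra.smul_def, mul_comm]
  have e : ∀ c : Γ(X, V), algebraMap (X.presheaf.stalk (hV.fromSpec ⟨p, hp⟩)) X.functionField
      (algebraMap Γ(X, V) (X.presheaf.stalk (hV.fromSpec ⟨p, hp⟩)) c) =
      algebraMap Γ(X, V) X.functionField c := fun c =>
    Scheme.algebraMap_germ_eq_germToFunctionField X hpV c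
  rw [e, e] at this
  exact this.symm

/-- A rational function on a normal Noetherian scheme which is regular in codimension one is a
global section. -/
theorem exists_global_section_eq [IsNormalScheme X] [IsLocallyNoetherian X] (f : X.functionField)
    (hf : ∀ x : X, coheight x = 1 → f ∈ (algebraMap (X.presheaf.stalk x) X.functionField).range) :
    ∃ a : Γ(X, ⊤), X.presheaf.germ ⊤ (genericPoint X) trivial a = f := by
  let ι := {V : X.affineOpens // Nonempty V.1}
  choose a ha using fun V : ι => haveI := V.2; exists_section_eq f hf V.1.2
  obtain ⟨b, hb, -⟩ := X.sheaf.existsUnique_gluing' (U := fun V : ι => V.1.1) ⊤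
    (fun V => homOfLE le_top) (fun x _ => by
      obtain ⟨_, ⟨V, hV, rfl⟩, hxV, -⟩ := X.isBasis_affineOpens.exists_subset_of_mem_open
        (Set.mem_univ x) isOpen_univ
      exact TopologicalSpace.Opens.mem_iSup.mpr ⟨⟨⟨V, hV⟩, ⟨⟨x, hxV⟩⟩⟩, hxV⟩) a (by
    intro V W
    have hmem : ∀ V : ι, genericPoint X ∈ V.1.1 := fun V =>
      ((genericPoint_spec X).mem_open_set_iff V.1.1.isOpen).mpr (by simpa using V.2)
    apply germ_injective_of_isIntegral X (U := V.1.1 ⊓ W.1.1) (genericPoint X) ⟨hmem V, hmem W⟩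
    refine (TopCat.Presheaf.germ_res_apply ..).trans
      (.trans ?_ (TopCat.Presheaf.germ_res_apply ..).symm)
    exact (ha V).trans (ha W).symm)
  obtain ⟨_, ⟨V, hV, rfl⟩, hxV, -⟩ := X.isBasis_affineOpens.exists_subset_of_mem_open
        (Set.mem_univ (genericPoint X)) isOpen_univ
  refine ⟨b, ?_⟩
  have h1 := hb ⟨⟨V, hV⟩, ⟨⟨_, hxV⟩⟩⟩
  have h2 := ha ⟨⟨V, hV⟩, ⟨⟨_, hxV⟩⟩⟩
  rw [← h1] at h2
  rw [← h2]
  exact (TopCat.Presheaf.germ_res_apply ..).symm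

/-- By Hartogs `f` is a global section, and global sections of a universally closed `k`-scheme are
integral over `k`. -/
theorem isIntegralElem_constants [IsNormalScheme X] [IsLocallyNoetherian X] {k : Type u} [Field k]
    (s : X ⟶ Spec (.of k)) [UniversallyClosed s] (f : X.functionField)
    (hf : ∀ x : X, coheight x = 1 → f ∈ (algebraMap (X.presheaf.stalk x) X.functionField).range) :
    (constants s).IsIntegralElem f := by
  obtain ⟨a, rfl⟩ := exists_global_section_eq f hf
  have h1 : ((Scheme.ΓSpecIso (.of k)).inv ≫ s.appTop).hom.IsIntegralElem a := by
    rw [CommRingCat.hom_comp]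
    exact RingHom.IsIntegral.trans _ _ (RingHom.isIntegral_of_surjective _
      (Scheme.ΓSpecIso (.of k)).symm.commRingCatIsoToRingEquiv.surjective)
      (isIntegral_appTop_of_universallyClosed s) a
  exact h1.map _

end Hartogs

end WeilLinearSystem

/-! ### Functions on `X_K` without zeros and poles are constant. -/

namespace WeilLinearSystem

section Units

variable {k : Type u} [Field k] {X : Scheme.{u}} [IsIntegral X] (s : X ⟶ Spec (.of k))
  (K : Type u) [Field K] [Algebra k K] [IsIntegral (BaseChange s K)]

theorem constants_mem_range (x : X) (c : k) :
    constants s c ∈ (algebraMap (X.presheaf.stalk x) X.functionField).range := by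
  have : Nonempty (⊤ : X.Opens) := ⟨⟨x, trivial⟩⟩
  exact ⟨X.presheaf.germ ⊤ x trivial (((Scheme.ΓSpecIso (.of k)).inv ≫ s.appTop) c),
    Scheme.algebraMap_germ_eq_germToFunctionField X _ _⟩

/-- Points of `X_K` over a point `x` of `X` are primes of the subring of `K(X_K)` generated by
`𝒪_{X,x}` and `K`. -/
theorem exists_point [Algebra.IsAlgebraic k K] (x : X) (C : Subring (BaseChange s K).functionField)
    (hC : C = Subring.closure (Set.range (fun a : X.presheaf.stalk x =>
      functionFieldMap (BaseChange.proj s K) (algebraMap _ X.functionField a)) ∪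
        Set.range (constants (BaseChange.str s K))))
    (Q : Ideal C) [hQp : Q.IsPrime] (hQ : ∀ (a : X.presheaf.stalk x) (c : C),
      (c : (BaseChange s K).functionField) =
        functionFieldMap (BaseChange.proj s K) (algebraMap _ X.functionField a) →
      (c ∈ Q ↔ ¬ IsUnit a)) :
    ∃ z : BaseChange s K, BaseChange.proj s K z = x ∧ ∀ c : C,
      ∃ b : (BaseChange s K).presheaf.stalk z, algebraMap _ (BaseChange s K).functionField b = c ∧
        (IsUnit b ↔ c ∉ Q) := by
  obtain ⟨_, ⟨V, hV, rfl⟩, hxV, -⟩ := X.isBasis_affineOpens.exists_subset_of_mem_open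
    (Set.mem_univ x) isOpen_univ
  have hU : IsAffineOpen (BaseChange.proj s K ⁻¹ᵁ V) := IsAffineOpen.preimage hV _
  have : Nonempty V := ⟨⟨x, hxV⟩⟩
  have hηU : genericPoint (BaseChange s K) ∈ BaseChange.proj s K ⁻¹ᵁ V := by
    change BaseChange.proj s K _ ∈ V
    rw [map_genericPoint]
    exact ((genericPoint_spec X).mem_open_set_iff V.isOpen).mpr ⟨x, trivial, hxV⟩
  have : Nonempty (BaseChange.proj s K ⁻¹ᵁ V) := ⟨⟨_, hηU⟩⟩
  have hmem : ∀ a : Γ(BaseChange s K, BaseChange.proj s K ⁻¹ᵁ V),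
      (BaseChange s K).germToFunctionField _ a ∈ C := by
    intro a
    rw [hC]
    refine Subring.closure_mono (Set.union_subset_union_left _ ?_)
      (germToFunctionField_mem_closure s K hV a)
    rintro _ ⟨r, rfl⟩
    refine ⟨X.presheaf.germ V x hxV r, ?_⟩
    dsimp only
    rw [Scheme.algebraMap_germ_eq_germToFunctionField]
  let ψ : Γ(BaseChange s K, BaseChange.proj s K ⁻¹ᵁ V) →+* C :=
    ((BaseChange s K).germToFunctionField _).hom.codRestrict C hmem
  -- The required point is the contraction of `Q` to the affine chart over `V`. It lies over `x`
  -- because, by `hQ`, `Q` contracts to the maximal ideal of the local ring at `x`.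
  let q : PrimeSpectrum Γ(BaseChange s K, BaseChange.proj s K ⁻¹ᵁ V) := ⟨Q.comap ψ, inferInstance⟩
  obtain ⟨z, hz⟩ : ∃ z : BaseChange s K, hU.fromSpec q = z := ⟨_, rfl⟩
  have hzU : z ∈ BaseChange.proj s K ⁻¹ᵁ V := by
    have := Set.mem_range_self (f := hU.fromSpec) q
    rwa [hU.range_fromSpec, hz] at this
  have hq : hU.primeIdealOf ⟨z, hzU⟩ = q := by
    apply hU.fromSpec.isOpenEmbedding.injective
    exact (hU.fromSpec_primeIdealOf ⟨z, hzU⟩).trans hz.symm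
  have hzx : BaseChange.proj s K z = x := by
    have h1 := IsAffineOpen.comap_primeIdealOf_appLE (f := BaseChange.proj s K) V hV _ hU le_rfl hzU
    have h2 : hV.primeIdealOf ⟨BaseChange.proj s K z, hzU⟩ = hV.primeIdealOf ⟨x, hxV⟩ := by
      rw [← h1, hq, hV.primeIdealOf_eq_map_closedPoint ⟨x, hxV⟩]
      ext r
      change ψ _ ∈ Q ↔ X.presheaf.germ V x hxV r ∈ IsLocalRing.maximalIdeal _
      rw [IsLocalRing.mem_maximalIdeal, mem_nonunits_iff]
      refine hQ _ _ ?_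
      rw [Scheme.algebraMap_germ_eq_germToFunctionField, Scheme.Hom.appLE_eq_app]
      have h3 := germ_functionFieldMap (BaseChange.proj s K) V
        (((genericPoint_spec X).mem_open_set_iff V.isOpen).mpr ⟨x, trivial, hxV⟩)
      exact congr($h3 r).symm
    have h4 := congr_arg hV.fromSpec h2
    exact (hV.fromSpec_primeIdealOf ⟨_, hzU⟩).symm.trans (h4.trans (hV.fromSpec_primeIdealOf _))
  refine ⟨z, hzx, fun c => ?_⟩
  subst hzx
  have hcz : (c : (BaseChange s K).functionField) ∈
      (algebraMap ((BaseChange s K).presheaf.stalk z) (BaseChange s K).functionField).range := by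
    refine Subring.closure_le.mpr ?_ (hC.le c.2)
    rintro _ (⟨a, rfl⟩ | ⟨c, rfl⟩)
    · exact ⟨_, (functionFieldMap_algebraMap _ z a).symm⟩
    · exact constants_mem_range _ z c
  obtain ⟨b, hb⟩ := hcz
  refine ⟨b, hb, ?_⟩
  let := (BaseChange s K).presheaf.algebra_section_stalk ⟨z, hzU⟩
  have hloc : IsLocalization.AtPrime ((BaseChange s K).presheaf.stalk z) q.asIdeal := by
    have h := hU.isLocalization_stalk ⟨z, hzU⟩
    rwa [hq] at h
  -- Write `b = r / t` with `t ∉ q`: then `b` is a unit iff `r ∉ q`, and `r = c t` in `C` turns this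
  -- into `c ∉ Q`.
  obtain ⟨⟨r, t⟩, hrt⟩ := IsLocalization.surj q.asIdeal.primeCompl b
  have ht := IsLocalization.map_units ((BaseChange s K).presheaf.stalk z) t
  have h1 : IsUnit b ↔ r ∉ q.asIdeal := by
    rw [← and_iff_left (a := IsUnit b) ht, ← IsUnit.mul_iff, hrt]
    exact IsLocalization.AtPrime.isUnit_to_map_iff _ q.asIdeal r
  have e : ∀ c, algebraMap ((BaseChange s K).presheaf.stalk z) (BaseChange s K).functionField
      (algebraMap Γ(BaseChange s K, BaseChange.proj s K ⁻¹ᵁ V) _ c) = ψ c :=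
    fun c => Scheme.algebraMap_germ_eq_germToFunctionField _ hzU c
  have h2 : ψ r = c * ψ t := by
    apply Subtype.ext
    have := congr_arg (algebraMap _ (BaseChange s K).functionField) hrt
    rw [map_mul, e, e, hb] at this
    exact this.symm
  rw [h1]
  change ψ r ∉ Q ↔ _
  rw [h2, hQp.mul_mem_iff_mem_or_mem, or_iff_left (show ψ t ∉ Q from t.2)]

/-- The function field of `X_K` is generated by that of `X` and by `K`. -/
theorem mem_adjoin_constants [Algebra.IsAlgebraic k K] [Algebra k X.functionField]
    [Algebra X.functionField (BaseChange s K).functionField]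
    [Algebra K (BaseChange s K).functionField] [Algebra k (BaseChange s K).functionField]
    [IsScalarTower k X.functionField (BaseChange s K).functionField]
    [IsScalarTower k K (BaseChange s K).functionField]
    (hF : algebraMap X.functionField (BaseChange s K).functionField =
      (functionFieldMap (BaseChange.proj s K)).hom)
    (hK : algebraMap K (BaseChange s K).functionField = constants (BaseChange.str s K))
    (u : (BaseChange s K).functionField) :
    u ∈ Algebra.adjoin X.functionField (Set.range (algebraMap K (BaseChange s K).functionField)) := by
  have halg : ∀ x ∈ Set.range (algebraMap K (BaseChange s K).functionField),
      IsAlgebraic X.functionField x := by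
    rintro _ ⟨c, rfl⟩
    have h1 : IsIntegral k c := Algebra.IsIntegral.isIntegral c
    have h2 := h1.map (IsScalarTower.toAlgHom k K (BaseChange s K).functionField)
    exact (h2.tower_top (A := X.functionField)).isAlgebraic
  -- The adjoined elements are algebraic, so the ring they generate is a field and fractions of
  -- sections cause no trouble.
  rw [← IntermediateField.adjoin_toSubalgebra_of_isAlgebraic halg]
  set E := IntermediateField.adjoin X.functionField
    (Set.range (algebraMap K (BaseChange s K).functionField))
  obtain ⟨_, ⟨V, hV, rfl⟩, hxV, -⟩ := X.isBasis_affineOpens.exists_subset_of_mem_open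
    (Set.mem_univ (genericPoint X)) isOpen_univ
  have hU : IsAffineOpen (BaseChange.proj s K ⁻¹ᵁ V) := IsAffineOpen.preimage hV _
  have : Nonempty V := ⟨⟨_, hxV⟩⟩
  have : Nonempty (BaseChange.proj s K ⁻¹ᵁ V) := ⟨⟨genericPoint (BaseChange s K), by
    change BaseChange.proj s K _ ∈ V
    rwa [map_genericPoint]⟩⟩
  have := functionField_isFractionRing_of_isAffineOpen _ _ hU
  have key : ∀ a : Γ(BaseChange s K, BaseChange.proj s K ⁻¹ᵁ V),
      (BaseChange s K).germToFunctionField _ a ∈ E := by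
    intro a
    refine (Subring.closure_le (t := E.toSubring)).mpr ?_ (germToFunctionField_mem_closure s K hV a)
    rintro _ (⟨r, rfl⟩ | ⟨c, rfl⟩)
    · have := E.algebraMap_mem (X.germToFunctionField V r)
      rw [hF] at this
      exact this
    · exact IntermediateField.subset_adjoin _ _ ⟨c, congr($hK c)⟩
  obtain ⟨a, b, -, rfl⟩ := IsFractionRing.div_surjective
    (A := Γ(BaseChange s K, BaseChange.proj s K ⁻¹ᵁ V)) u
  exact E.div_mem (key a) (key b)

end Units

end WeilLinearSystem

namespace WeilLinearSystem

section Units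

variable {k : Type u} [Field k] {X : Scheme.{u}} [IsIntegral X] (s : X ⟶ Spec (.of k))
  (K : Type u) [Field K] [Algebra k K] [IsIntegral (BaseChange s K)]

/-- An element of `F(θ)`, `θ ∈ K` separable over `k`, without zeros and poles on `X_K` is integral
over the local rings of `X` in codimension one. -/
theorem isIntegralElem_stalk_of_ord_eq_zero [Algebra.IsAlgebraic k K] [IsNormalScheme X]
    [IsLocallyNoetherian X] [IsLocallyNoetherian (BaseChange s K)] {θ : K} (hθ : IsSeparable k θ)
    [Algebra X.functionField (BaseChange s K).functionField]
    (hF : algebraMap X.functionField (BaseChange s K).functionField =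
      (functionFieldMap (BaseChange.proj s K)).hom)
    {w : (BaseChange s K).functionField} (hw0 : w ≠ 0)
    (hw : w ∈ IntermediateField.adjoin X.functionField {constants (BaseChange.str s K) θ})
    (h : ∀ z : BaseChange s K, coheight z = 1 → (BaseChange s K).ord w z = 0)
    {x : X} (hx : coheight x = 1) :
    ((functionFieldMap (BaseChange.proj s K)).hom.comp
      (algebraMap (X.presheaf.stalk x) X.functionField)).IsIntegralElem w := by
  let F := X.functionField
  let M := (BaseChange s K).functionField
  let A := X.presheaf.stalk x
  have := isDiscreteValuationRing_stalk hx
  let i1 : Algebra k F := (constants s).toAlgebra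
  let i2 : Algebra K M := (constants (BaseChange.str s K)).toAlgebra
  let i3 : Algebra k M := ((constants (BaseChange.str s K)).comp (algebraMap k K)).toAlgebra
  have t1 : IsScalarTower k K M := .of_algebraMap_eq fun _ => rfl
  have t2 : IsScalarTower k F M := .of_algebraMap_eq fun c => by
    rw [hF]
    exact (functionFieldMap_proj_constants s K c).symm
  let i4 : Algebra A M := ((algebraMap F M).comp (algebraMap A F)).toAlgebra
  have t3 : IsScalarTower A F M := .of_algebraMap_eq fun _ => rfl
  let i5 : Algebra k A := (X.presheaf.germ ⊤ x trivial).hom.comp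
    ((Scheme.ΓSpecIso (.of k)).inv ≫ s.appTop).hom |>.toAlgebra
  have t4 : IsScalarTower k A F := .of_algebraMap_eq fun c => by
    have : Nonempty (⊤ : X.Opens) := ⟨⟨x, trivial⟩⟩
    exact (Scheme.algebraMap_germ_eq_germToFunctionField X (U := ⊤) (x := x) trivial _).symm
  have t5 : IsScalarTower k A M := .of_algebraMap_eq fun c => by
    rw [IsScalarTower.algebraMap_apply A F M, ← IsScalarTower.algebraMap_apply k A F,
      ← IsScalarTower.algebraMap_apply k F M]
  have hA : algebraMap A M = (functionFieldMap (BaseChange.proj s K)).hom.comp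
      (algebraMap (X.presheaf.stalk x) X.functionField) := by
    rw [← hF]; rfl
  rw [← hA]
  by_contra hwA
  -- Primes of `C = A[K]` over the maximal ideal of `A` are points of `X_K` over `x`. If `w` is not
  -- integral, one of them carries a relation `w σ = τ` with `τ` a unit and `σ` of positive order,
  -- so `ord w < 0` there.
  let C := Algebra.adjoin A (Set.range (algebraMap K M))
  have hKk : ∀ c : K, IsIntegral k (algebraMap K M c) := fun c =>
    (Algebra.IsIntegral.isIntegral (R := k) c).map (IsScalarTower.toAlgHom k K M)
  have hCint : Algebra.IsIntegral A C := Algebra.IsIntegral.adjoin (by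
    rintro _ ⟨c, rfl⟩
    exact (hKk c).tower_top)
  have hθs : IsSeparable F (algebraMap K M θ) :=
    (hθ.map (IsScalarTower.toAlgHom k K M) (algebraMap K M).injective).tower_top F
  obtain ⟨Q, hQ, hQA, σ, hσ, τ, hτ, hστ⟩ := exists_prime_of_not_isIntegral (k := k) (A := A)
    (F := F) (M := M) (hKk θ) hθs hw hwA C (Algebra.subset_adjoin ⟨θ, rfl⟩)
  obtain ⟨z, hz, hzQ⟩ := exists_point s K x C.toSubring (by
    have := Algebra.adjoin_eq_ring_closure (R := A) (Set.range (algebraMap K M))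
    rw [hA] at this
    exact this) Q (hQp := hQ) (by
    intro a c hc
    have hc' : c = algebraMap A C a := Subtype.ext (hc.trans congr($hA a).symm)
    rw [hc', ← mem_nonunits_iff, ← IsLocalRing.mem_maximalIdeal, ← hQA]
    rfl)
  have hz1 : coheight z = 1 := by rw [← BaseChange.coheight_proj s K, hz, hx]
  obtain ⟨b, hb, hbQ⟩ := hzQ σ
  obtain ⟨d, hd, hdQ⟩ := hzQ τ
  have hd1 : IsUnit d := hdQ.mpr hτ
  have hb1 : ¬ IsUnit b := fun h => hbQ.mp h hσ
  have hb0 : b ≠ 0 := by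
    rintro rfl
    rw [map_zero] at hb
    rw [← hb, mul_zero, ← hd] at hστ
    exact hd1.ne_zero ((map_eq_zero_iff _ (IsFractionRing.injective _ _)).mp hστ.symm)
  have h1 := ord_algebraMap_pos hz1 hb0 hb1
  have h2 := ord_algebraMap_of_isUnit hz1 hd1
  rw [hb] at h1
  rw [hd, ← hστ, Scheme.ord_mul hw0, h z hz1, zero_add] at h2
  · exact h1.ne' h2
  · rw [← hb]
    exact (map_ne_zero_iff _ (IsFractionRing.injective _ _)).mpr hb0

/-- A rational function on `X_K` without zeros and poles is constant, although `X_K` need not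
be normal. -/
theorem mem_range_constants_of_ord_eq_zero [IsAlgClosure k K] [IsNormalScheme X]
    [IsLocallyNoetherian X] [IsLocallyNoetherian (BaseChange s K)] [UniversallyClosed s]
    {u : (BaseChange s K).functionField} (hu : u ≠ 0)
    (h : ∀ z : BaseChange s K, coheight z = 1 → (BaseChange s K).ord u z = 0) :
    u ∈ (constants (BaseChange.str s K)).range := by
  have := IsAlgClosure.isAlgebraic (R := k) (K := K)
  have := IsAlgClosure.isAlgClosed k (K := K)
  let F := X.functionField
  let M := (BaseChange s K).functionField
  let i0 : Algebra F M := (functionFieldMap (BaseChange.proj s K)).hom.toAlgebra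
  let i1 : Algebra k F := (constants s).toAlgebra
  let i2 : Algebra K M := (constants (BaseChange.str s K)).toAlgebra
  let i3 : Algebra k M := ((constants (BaseChange.str s K)).comp (algebraMap k K)).toAlgebra
  have t1 : IsScalarTower k K M := .of_algebraMap_eq fun _ => rfl
  have t2 : IsScalarTower k F M := .of_algebraMap_eq fun c =>
    (functionFieldMap_proj_constants s K c).symm
  obtain ⟨n, hn, θ, hθ, hw⟩ := exists_pow_mem_adjoin_separable (k := k) (K := K) (F := F) (M := M)
    (mem_adjoin_constants s K rfl rfl u)
  have hint : ∀ x : X, coheight x = 1 →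
      ((algebraMap F M).comp (algebraMap (X.presheaf.stalk x) F)).IsIntegralElem (u ^ n) :=
    fun x hx => isIntegralElem_stalk_of_ord_eq_zero s K hθ rfl (pow_ne_zero n hu) hw
      (fun z hz => by rw [ord_pow hu, h z hz, mul_zero]) hx
  have hθF : IsIntegral F (algebraMap K M θ) :=
    (hθ.isIntegral.map (IsScalarTower.toAlgHom k K M)).tower_top
  have : FiniteDimensional F (IntermediateField.adjoin F {algebraMap K M θ}) :=
    IntermediateField.adjoin.finiteDimensional hθF
  have hwF : IsIntegral F (u ^ n) :=
    (Algebra.IsIntegral.isIntegral (R := F)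
      (⟨u ^ n, hw⟩ : IntermediateField.adjoin F {algebraMap K M θ})).map
        (IntermediateField.adjoin F {algebraMap K M θ}).val
  -- Over an integrally closed local ring the minimal polynomial of an integral element already has
  -- its coefficients in that ring, so they are regular in codimension one on `X`.
  have hcoeff : ∀ i, IsIntegral k ((minpoly F (u ^ n)).coeff i) := by
    intro i
    refine isIntegralElem_constants s _ fun x hx => ?_
    have := isDiscreteValuationRing_stalk hx
    let i4 : Algebra (X.presheaf.stalk x) M :=
      ((algebraMap F M).comp (algebraMap (X.presheaf.stalk x) F)).toAlgebra
    have t3 : IsScalarTower (X.presheaf.stalk x) F M := .of_algebraMap_eq fun _ => rfl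
    rw [minpoly.isIntegrallyClosed_eq_field_fractions' (K := F) (R := X.presheaf.stalk x)
      (hint x hx), Polynomial.coeff_map]
    exact ⟨_, rfl⟩
  have hwk : IsIntegral k (u ^ n) := by
    let P := (integralClosure k F)
    have hP : IsIntegral P (u ^ n) := by
      have hl : minpoly F (u ^ n) ∈ Polynomial.lifts (algebraMap P F) := by
        rw [Polynomial.lifts_iff_coeff_lifts]
        exact fun i => ⟨⟨_, hcoeff i⟩, rfl⟩
      obtain ⟨q, hq, -, hqm⟩ := Polynomial.lifts_and_degree_eq_and_monic hl (minpoly.monic hwF)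
      refine ⟨q, hqm, ?_⟩
      have := minpoly.aeval F (u ^ n)
      rw [← hq, Polynomial.aeval_map_algebraMap] at this
      exact this
    exact isIntegral_trans _ hP
  have huk : IsIntegral K u := (IsIntegral.of_pow hn hwk).tower_top
  have : Algebra.IsIntegral K (Algebra.adjoin K {u}) :=
    Algebra.IsIntegral.adjoin (by rintro _ rfl; exact huk)
  obtain ⟨c, hc⟩ := (IsAlgClosed.algebraMap_bijective_of_isIntegral (k := K)
    (K := Algebra.adjoin K {u})).2 ⟨u, Algebra.self_mem_adjoin_singleton K u⟩
  exact ⟨c, congr_arg Subtype.val hc⟩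

end Units

end WeilLinearSystem

/-! ### Linear independence after extension of scalars. -/

/-- An independent family extends to a basis of `B` over the field `A`, and a basis stays a basis
after base change. `IsField` is used because `A` will be `Γ(Spec k, ⊤)`, which is only isomorphic to
`k`. -/
theorem CommRingCat.eq_zero_of_isPushout {A B C D : CommRingCat.{u}} (hA : IsField A) {f : A ⟶ B}
    {g : A ⟶ C} {i : B ⟶ D} {j : C ⟶ D} (h : IsPushout f g i j) {ι : Type*} [Fintype ι] {b : ι → B}
    (hb : ∀ c : ι → A, ∑ l, f (c l) * b l = 0 → c = 0) {x : ι → C}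
    (hx : ∑ l, j (x l) * i (b l) = 0) : x = 0 := by
  let := hA.toField
  algebraize [f.hom, g.hom, i.hom, j.hom, i.hom.comp f.hom]
  have : IsScalarTower A C D := .of_algebraMap_eq fun a => congr($h.w a)
  have hP : Algebra.IsPushout A C B D := CommRingCat.isPushout_iff_isPushout.mp h.flip
  have hli : LinearIndependent A b := Fintype.linearIndependent_iff.mpr fun c hc =>
    congr_fun (hb c (by rw [← hc]; exact Finset.sum_congr rfl fun l _ => (Algebra.smul_def _ _).symm))
  let β := Module.Basis.extend hli.linearIndepOn_id
  let v (l : ι) : hli.linearIndepOn_id.extend (Set.subset_univ _) :=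
    ⟨b l, hli.linearIndepOn_id.subset_extend _ (Set.mem_range_self l)⟩
  have hv : Function.Injective v := fun l m hlm => hli.injective (congr_arg Subtype.val hlm)
  have h1 := (IsBaseChange.basis β hP.out).linearIndependent.comp v hv
  refine funext (Fintype.linearIndependent_iff.mp h1 x ?_)
  rw [← hx]
  refine Finset.sum_congr rfl fun l _ => ?_
  rw [Algebra.smul_def, Function.comp_apply, IsBaseChange.basis_apply]
  simp [β, v]
  rfl

namespace WeilLinearSystem

section FunctionFields

variable {k : Type u} [Field k] {X Y Z : Scheme.{u}} [IsIntegral X] [IsIntegral Y] [IsIntegral Z]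

theorem functionFieldMap_comp (f : Z ⟶ Y) (g : Y ⟶ X) [IsDominant f] [IsDominant g]
    [IsDominant (f ≫ g)] (a : X.functionField) :
    functionFieldMap f (functionFieldMap g a) = functionFieldMap (f ≫ g) a := by
  obtain ⟨U, hU, s, rfl⟩ := X.presheaf.exists_germ_eq a
  have h1 := congr($(germ_functionFieldMap g U hU) s)
  have h2 := congr($(germ_functionFieldMap (f ≫ g) U hU) s)
  have hU' : genericPoint Y ∈ g ⁻¹ᵁ U := show g (genericPoint Y) ∈ U by rwa [map_genericPoint g]
  have h3 := congr($(germ_functionFieldMap f (g ⁻¹ᵁ U) hU') (g.app U s))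
  refine (congr_arg _ h1).trans (h3.trans (Eq.trans ?_ h2.symm))
  simp only [Scheme.Hom.comp_app]
  rfl

theorem eq_zero_of_linComb_eq_zero (s : X ⟶ Spec (.of k)) (K : Type u) [Field K] [Algebra k K]
    [IsIntegral (BaseChange s K)] {n : ℕ} {f : Fin (n + 1) → X.functionField}
    (hf : ∀ c : Fin (n + 1) → k, linComb s f c = 0 → c = 0) {c : Fin (n + 1) → K}
    (hc : linComb (BaseChange.str s K) (fun i => functionFieldMap (BaseChange.proj s K) (f i)) c
      = 0) : c = 0 := by
  obtain ⟨_, ⟨V, hV, rfl⟩, hxV, -⟩ := X.isBasis_affineOpens.exists_subset_of_mem_open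
    (Set.mem_univ (genericPoint X)) isOpen_univ
  have hηV : genericPoint (BaseChange s K) ∈ BaseChange.proj s K ⁻¹ᵁ V := by
    change BaseChange.proj s K _ ∈ V
    rwa [map_genericPoint]
  have : Nonempty V := ⟨⟨_, hxV⟩⟩
  have : Nonempty (BaseChange.proj s K ⁻¹ᵁ V) := ⟨⟨_, hηV⟩⟩
  have := functionField_isFractionRing_of_isAffineOpen X V hV
  -- A common denominator turns the `fᵢ` into sections over an affine `V`, where base change is a
  -- pushout of rings.
  obtain ⟨b, hb⟩ := IsLocalization.exist_integer_multiples_of_finite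
    (nonZeroDivisors Γ(X, V)) f
  have hbi : ∀ i, ∃ a : Γ(X, V), X.germToFunctionField V a = X.germToFunctionField V b.1 * f i := by
    intro i
    obtain ⟨a, ha⟩ := hb i
    exact ⟨a, ha.trans (Algebra.smul_def _ _)⟩
  choose a ha using hbi
  have hb0 : X.germToFunctionField V b.1 ≠ 0 :=
    IsFractionRing.to_map_ne_zero_of_mem_nonZeroDivisors b.2
  have hpo := (isIso_pushoutSection_iff (BaseChange.isPullback s K) (US := ⊤) (UT := ⊤) (UX := V)
    (UY := BaseChange.proj s K ⁻¹ᵁ V) (by simp) (by simp) (by simp)).mp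
    (isIso_pushoutSection_of_isAffineOpen (BaseChange.isPullback s K) _ _ _
      (isAffineOpen_top _) (isAffineOpen_top _) hV)
  have hA : IsField Γ(Spec (.of k), ⊤) :=
    (Scheme.ΓSpecIso (.of k)).commRingCatIsoToRingEquiv.isField (Field.toIsField k)
  have hc0 := CommRingCat.eq_zero_of_isPushout hA hpo (b := a)
    (x := fun i => (Scheme.ΓSpecIso (.of K)).inv (c i)) ?_ ?_
  · funext i
    exact (map_eq_zero_iff _ (Scheme.ΓSpecIso
      (.of K)).symm.commRingCatIsoToRingEquiv.injective).mp (congr_fun hc0 i)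
  · intro e he
    have h1 := hf (fun i => (Scheme.ΓSpecIso (.of k)).hom (e i)) ?_
    · funext i
      exact (map_eq_zero_iff _ (Scheme.ΓSpecIso
        (.of k)).commRingCatIsoToRingEquiv.injective).mp (congr_fun h1 i)
    · have h2 := congr_arg (X.germToFunctionField V) he
      rw [map_sum, map_zero] at h2
      refine (mul_eq_zero_iff_left hb0).mp ?_
      rw [← h2, linComb, Finset.mul_sum]
      refine Finset.sum_congr rfl fun i _ => ?_
      refine .trans ?_ ((map_mul _ _ _).trans
        (congr_arg₂ (· * ·) (germToFunctionField_appLE s V _ (e i)) (ha i))).symm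
      dsimp only
      ring
  · apply Scheme.germToFunctionField_injective (BaseChange s K) (BaseChange.proj s K ⁻¹ᵁ V)
    rw [map_sum, map_zero]
    refine .trans ?_ ((congr_arg (functionFieldMap (BaseChange.proj s K)
      (X.germToFunctionField V b.1) * ·) hc).trans (mul_zero _))
    dsimp only
    rw [linComb, Finset.mul_sum]
    refine Finset.sum_congr rfl fun i _ => ?_
    have h1 : (Scheme.ΓSpecIso (.of K)).hom ((Scheme.ΓSpecIso (.of K)).inv (c i)) = c i :=
      congr($((Scheme.ΓSpecIso (.of K)).inv_hom_id) (c i))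
    have h2 := germToFunctionField_appLE_eq_functionFieldMap (BaseChange.proj s K) V (a i)
    rw [ha, map_mul] at h2
    refine ((map_mul _ _ _).trans (congr_arg₂ (· * ·) (germToFunctionField_appLE
      (BaseChange.str s K) _ _ _) h2)).trans ?_
    rw [h1]
    ring

end FunctionFields

end WeilLinearSystem

/-! ### Corresponding points and the coefficients of birational transforms. -/

namespace WeilLinearSystem

section Corresponds

variable {U X Y : Scheme.{u}} [IsIntegral U] [IsIntegral X] [IsIntegral Y]

/-- A point of a separated integral scheme is determined by its local ring in the function
field. -/
theorem eq_of_range_algebraMap_stalk_eq [X.IsSeparated]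
    {x y : X} (h : (algebraMap (X.presheaf.stalk x) X.functionField).range =
      (algebraMap (X.presheaf.stalk y) X.functionField).range) : x = y := by
  have hinj (z : X) : Function.Injective (algebraMap (X.presheaf.stalk z) X.functionField) :=
    IsFractionRing.injective _ _
  let r (z : X) : X.presheaf.stalk z ≃+* (algebraMap (X.presheaf.stalk z) X.functionField).range :=
    RingEquiv.ofBijective (algebraMap (X.presheaf.stalk z) X.functionField).rangeRestrict
      ⟨fun a b hab => hinj z (congr_arg Subtype.val hab),
        (algebraMap (X.presheaf.stalk z) X.functionField).rangeRestrict_surjective⟩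
  let φ : X.presheaf.stalk y ≅ X.presheaf.stalk x :=
    ((r y).trans ((RingEquiv.subringCongr h.symm).trans (r x).symm)).toCommRingCatIso
  have hφ : φ.hom ≫ X.presheaf.stalkSpecializes ((genericPoint_spec X).specializes trivial) =
      X.presheaf.stalkSpecializes ((genericPoint_spec X).specializes trivial) := by
    ext a
    exact congr_arg Subtype.val ((r x).apply_symm_apply (RingEquiv.subringCongr h.symm (r y a)))
  let ι : Spec X.functionField ⟶ Spec (X.presheaf.stalk x) :=
    Spec.map (X.presheaf.stalkSpecializes ((genericPoint_spec X).specializes trivial))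
  have : IsDominant ι := by
    exact ⟨(PrimeSpectrum.denseRange_comap_iff_ker_le_nilRadical _).mpr
      (((RingHom.injective_iff_ker_eq_bot _).mp (hinj x)).trans_le bot_le)⟩
  -- Both morphisms from the spectrum of the common local ring agree at the generic point, hence
  -- everywhere since `X` is separated; their closed points map to `x` and `y`.
  have h1 : X.fromSpecStalk x = Spec.map φ.hom ≫ X.fromSpecStalk y := by
    refine ext_of_isDominant ι ?_
    rw [Scheme.SpecMap_stalkSpecializes_fromSpecStalk, ← Spec.map_comp_assoc, hφ,
      Scheme.SpecMap_stalkSpecializes_fromSpecStalk]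
  have h2 : Spec.map φ.hom (IsLocalRing.closedPoint _) = IsLocalRing.closedPoint _ :=
    IsLocalRing.comap_closedPoint φ.hom.hom
  exact Scheme.fromSpecStalk_closedPoint.symm.trans (congr($h1 (IsLocalRing.closedPoint _)).trans
    ((congr_arg (X.fromSpecStalk y) h2).trans Scheme.fromSpecStalk_closedPoint))

variable (a : U ⟶ X) (b : U ⟶ Y) [IsOpenImmersion a] [IsOpenImmersion b]

theorem range_algebraMap_stalk_map_functionFieldEquiv (z : U) :
    (algebraMap (X.presheaf.stalk (a z)) X.functionField).range.map
      (functionFieldEquiv a).toRingHom = (algebraMap (U.presheaf.stalk z) U.functionField).range := by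
  have := isDominant_of_isOpenImmersion a
  ext f
  constructor
  · rintro ⟨_, ⟨c, rfl⟩, rfl⟩
    exact ⟨_, (functionFieldMap_algebraMap a z c).symm⟩
  · rintro ⟨c, rfl⟩
    obtain ⟨d, rfl⟩ := (asIso (a.stalkMap z)).commRingCatIsoToRingEquiv.surjective c
    exact ⟨_, ⟨d, rfl⟩, functionFieldMap_algebraMap a z d⟩

theorem corresponds_apply (z : U) : Corresponds a b (a z) (b z) := by
  have h1 := range_algebraMap_stalk_map_functionFieldEquiv a z
  have h2 := range_algebraMap_stalk_map_functionFieldEquiv b z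
  ext f
  constructor
  · rintro ⟨g, hg, rfl⟩
    obtain ⟨f, hf, h⟩ := (h1.trans h2.symm).le ⟨g, hg, rfl⟩
    have : (functionFieldEquiv b).symm (functionFieldEquiv a g) = f :=
      (RingEquiv.symm_apply_eq _).mpr h.symm
    exact this ▸ hf
  · intro hf
    obtain ⟨g, hg, h⟩ := (h2.trans h1.symm).le ⟨f, hf, rfl⟩
    exact ⟨g, hg, (RingEquiv.symm_apply_eq _).mpr h⟩

theorem exists_corresponds {y : Y} (hy : coheight y = 1) (h : y ∈ Set.range b) :
    ∃ x : PrimeDivisor X, Corresponds a b x.1 y := by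
  obtain ⟨z, rfl⟩ := h
  refine ⟨⟨a z, ?_⟩, corresponds_apply a b z⟩
  rw [← hy]
  exact (coheight_eq_of_isOpenImmersion a).trans (coheight_eq_of_isOpenImmersion b).symm

/-- The coefficient of the birational transform along a prime divisor corresponding to one of
`X`. -/
theorem divisorTransform_apply [X.IsSeparated] [Y.IsSeparated] (D : WeilDivisor X) {x : PrimeDivisor X}
    {y : PrimeDivisor Y} (h : Corresponds a b x.1 y.1) : divisorTransform a b D y = D x := by
  classical
  have huy {x : PrimeDivisor X} {y y' : PrimeDivisor Y} (h : Corresponds a b x.1 y.1)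
      (h' : Corresponds a b x.1 y'.1) : y = y' :=
    Subtype.ext (eq_of_range_algebraMap_stalk_eq (h.symm.trans h'))
  have hinj : Function.Injective (Subring.map (birationalEquiv a b).toRingHom) :=
    Function.LeftInverse.injective
      (Subring.comap_map_eq_self_of_injective (birationalEquiv a b).injective)
  have hux {x' : PrimeDivisor X} (h' : Corresponds a b x'.1 y.1) : x' = x :=
    Subtype.ext (eq_of_range_algebraMap_stalk_eq
      (hinj (h'.trans h.symm)))
  rw [divisorTransform, Finsupp.sum_apply, Finsupp.sum, Finset.sum_eq_single x]
  · have hex : ∃ y : PrimeDivisor Y, Corresponds a b x.1 y.1 := ⟨y, h⟩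
    rw [dif_pos hex, huy hex.choose_spec h, Finsupp.single_eq_same]
  · intro x' _ hx'
    split_ifs with hex
    · refine Finsupp.single_eq_of_ne fun hne => hx' (hux ?_)
      rw [hne]
      exact hex.choose_spec
    · rfl
  · intro hx
    rw [Finsupp.notMem_support_iff.mp hx]
    split_ifs <;> simp

theorem divisorTransform_apply_eq_zero (D : WeilDivisor X) {y : PrimeDivisor Y}
    (h : ∀ x : PrimeDivisor X, ¬ Corresponds a b x.1 y.1) : divisorTransform a b D y = 0 := by
  classical
  rw [divisorTransform, Finsupp.sum_apply]
  refine Finset.sum_eq_zero fun x _ => ?_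
  dsimp only
  split_ifs with hex
  · refine Finsupp.single_eq_of_ne fun hne => h x ?_
    rw [hne]
    exact hex.choose_spec
  · rfl

end Corresponds

/-! ### Coefficients of the members of a linear system. -/

section Members

variable {k : Type u} [Field k] {U X Y : Scheme.{u}} [IsIntegral X] [IsIntegral Y]

theorem minOrd_functionFieldMap {Z : Scheme.{u}} [IsIntegral Z] [IsLocallyNoetherian X]
    [IsLocallyNoetherian Z] [IsNormalScheme X] (p : Z ⟶ X) [IsDominant p] {z : Z}
    (hz : coheight z = 1) (hx : coheight (p z) = 1) {n : ℕ} {f : Fin (n + 1) → X.functionField}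
    (hf : ∀ i, f i ≠ 0) :
    minOrd (fun i => functionFieldMap p (f i)) z = minOrd f (p z) *
      ((Module.length (Z.presheaf.stalk z) (Z.presheaf.stalk z ⧸
      (IsLocalRing.maximalIdeal (X.presheaf.stalk (p z))).map (p.stalkMap z).hom)).toNat : ℤ) := by
  have key (m : ℕ) (g : Fin (n + 1) → ℤ) :
      Finset.univ.inf' Finset.univ_nonempty (fun i => g i * (m : ℤ)) =
        Finset.univ.inf' Finset.univ_nonempty g * m :=
    (Finset.apply_inf'_eq_inf'_comp (f := g) _ (fun a : ℤ => a * m) fun a b =>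
      (show Monotone fun a : ℤ => a * m from fun a b h => by dsimp only; gcongr).map_min).symm
  rw [minOrd, minOrd, ← key]
  exact Finset.inf'_congr _ rfl fun i _ => ord_functionFieldMap p hz hx (hf i)

theorem minOrd_birationalEquiv [IsIntegral U] [IsLocallyNoetherian X] [IsLocallyNoetherian Y]
    (a : U ⟶ X) (b : U ⟶ Y) [IsOpenImmersion a] [IsOpenImmersion b] {x : X} {y : Y}
    (hx : coheight x = 1) (hy : coheight y = 1) (h : Corresponds a b x y) {n : ℕ}
    (f : Fin (n + 1) → X.functionField) :
    minOrd (fun i => birationalEquiv a b (f i)) y = minOrd f x :=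
  Finset.inf'_congr _ rfl fun i _ => ord_eq_ord_of_range_eq (birationalEquiv a b) hx hy h (f i)

variable [AlgebraicGeometry.IsNoetherian X] {s : X ⟶ Spec (.of k)}
  (L : LinearSystem s)

/-- Needed because the zero function is given order `0`, which would falsify minima of orders. -/
theorem LinearSystem.basis_ne_zero (i : Fin (L.dim + 1)) : L.basis i ≠ 0 := by
  classical
  intro h
  have h1 := L.linearIndependent (Pi.single i 1) (by
    rw [linComb, Finset.sum_eq_single i] <;> simp +contextual [h])
  simpa using congr_fun h1 i

/-- A member avoiding `x` bounds the coefficient above; effectivity of the members given by the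
basis bounds it below. -/
theorem LinearSystem.NoFixedComponents.divisor_apply [IsNormalScheme X] {L : LinearSystem s}
    (hL : L.NoFixedComponents)
    (x : PrimeDivisor X) : L.divisor x = -minOrd L.basis x.1 := by
  classical
  apply le_antisymm
  · obtain ⟨c, hc, h⟩ := hL x
    have h1 := minOrd_le_ord_linComb s L.basis c x.2 fun h0 => hc (L.linearIndependent c h0)
    have h2 : L.divisor x + X.ord (linComb s L.basis c) x.1 = 0 := h
    linarith
  · have h1 (i) : -L.divisor x ≤ X.ord (L.basis i) x.1 := by
      have h2 := L.effective (Pi.single i 1) (by simp) x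
      have h3 : linComb s L.basis (Pi.single i 1) = L.basis i := by
        rw [linComb, Finset.sum_eq_single i] <;> simp +contextual
      rw [h3] at h2
      have h4 : 0 ≤ L.divisor x + X.ord (L.basis i) x.1 := h2
      linarith
    have h2 : -L.divisor x ≤ minOrd L.basis x.1 := Finset.le_inf' _ _ fun i _ => h1 i
    linarith

/-- The same length multiplies the coefficient of the pulled-back divisor and the orders of
pulled-back functions. The hypothesis `hL` covers both a system without fixed components and, by
definition, a transform. -/
theorem LinearSystem.member_apply [IsNormalScheme X] [IsProper s] [GeometricallyIntegral s]
    {K : Type u} [Field K] [Algebra k K] [Algebra.IsAlgebraic k K] (hL : ∀ x, L.divisor x = -minOrd L.basis x.1)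
    (v : L.Points K) (z : PrimeDivisor (BaseChange s K)) :
    L.member v z = -minOrd (fun i => functionFieldMap (BaseChange.proj s K) (L.basis i)) z.1 +
      (BaseChange s K).ord (linComb (BaseChange.str s K)
        (fun i => functionFieldMap (BaseChange.proj s K) (L.basis i)) v.rep) z.1 := by
  have hx : coheight (BaseChange.proj s K z.1) = 1 := by rw [BaseChange.coheight_proj, z.2]
  change pullbackCoeff _ _ z + _ = _
  rw [pullbackCoeff, dif_pos hx, hL, minOrd_functionFieldMap _ z.2 hx L.basis_ne_zero, neg_mul]
  rfl

end Members

end WeilLinearSystem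

/-! ### Base change of the birational map, and comparison of the two transforms. -/

namespace WeilLinearSystem

section BaseChangeMap

variable {k : Type u} [Field k] {U X : Scheme.{u}} {sU : U ⟶ Spec (.of k)} {sX : X ⟶ Spec (.of k)}

theorem BaseChange.map_proj (K : Type u) [Field K] [Algebra k K] (f : U ⟶ X)
    (h : sU = f ≫ sX) :
    BaseChange.map K f h ≫ BaseChange.proj sX K = BaseChange.proj sU K ≫ f :=
  pullback.lift_fst _ _ _

theorem BaseChange.map_str (K : Type u) [Field K] [Algebra k K] (f : U ⟶ X)
    (h : sU = f ≫ sX) :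
    BaseChange.map K f h ≫ BaseChange.str sX K = BaseChange.str sU K :=
  (pullback.lift_snd _ _ _).trans (Category.comp_id _)

end BaseChangeMap

section

variable {k : Type u} [Field k] {U X Y : Scheme.{u}} [IsIntegral X] [IsIntegral Y]

section BirationalBaseChange

variable [IsIntegral U] {sU : U ⟶ Spec (.of k)} {sX : X ⟶ Spec (.of k)} {sY : Y ⟶ Spec (.of k)}
  (a : U ⟶ X) (b : U ⟶ Y) [IsOpenImmersion a] [IsOpenImmersion b] (ha : sU = a ≫ sX)
  (hb : sU = b ≫ sY) (K : Type u) [Field K] [Algebra k K] [IsIntegral (BaseChange sU K)]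
  [IsIntegral (BaseChange sX K)] [IsIntegral (BaseChange sY K)]

theorem functionFieldEquiv_functionFieldMap_proj (f : X.functionField) :
    functionFieldEquiv (BaseChange.map K a ha) (functionFieldMap (BaseChange.proj sX K) f) =
      functionFieldMap (BaseChange.proj sU K) (functionFieldEquiv a f) := by
  have := isDominant_of_isOpenImmersion a
  have := isDominant_of_isOpenImmersion (BaseChange.map K a ha)
  have h {p q : BaseChange sU K ⟶ X} [IsDominant p] [IsDominant q] (h : p = q) :
      functionFieldMap p f = functionFieldMap q f := by subst h; rfl
  exact (functionFieldMap_comp _ _ f).trans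
    ((h (BaseChange.map_proj K a ha)).trans (functionFieldMap_comp _ _ f).symm)

theorem birationalEquiv_functionFieldMap_proj (f : X.functionField) :
    birationalEquiv (BaseChange.map K a ha) (BaseChange.map K b hb)
      (functionFieldMap (BaseChange.proj sX K) f) =
        functionFieldMap (BaseChange.proj sY K) (birationalEquiv a b f) := by
  rw [birationalEquiv, RingEquiv.trans_apply, RingEquiv.symm_apply_eq,
    functionFieldEquiv_functionFieldMap_proj, functionFieldEquiv_functionFieldMap_proj,
    birationalEquiv, RingEquiv.trans_apply, RingEquiv.apply_symm_apply]

end BirationalBaseChange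

section Transform

variable [IsIntegral U] [AlgebraicGeometry.IsNoetherian X] [IsNormalScheme X]
  [AlgebraicGeometry.IsNoetherian Y] [IsNormalScheme Y]
  {sX : X ⟶ Spec (.of k)} {sY : Y ⟶ Spec (.of k)} [IsProper sX] [GeometricallyIntegral sX]
  [IsProper sY] [GeometricallyIntegral sY] (a : U ⟶ X) (b : U ⟶ Y) [IsOpenImmersion a]
  [IsOpenImmersion b] (h : a ≫ sX = b ≫ sY) {K : Type u} [Field K] [Algebra k K]
  [Algebra.IsAlgebraic k K] [IsIntegral (BaseChange (a ≫ sX) K)] {L : LinearSystem sX}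

instance isSeparated_baseChange (s : X ⟶ Spec (.of k)) [IsProper s] (K : Type u) [Field K]
    [Algebra k K] : (BaseChange s K).IsSeparated := by
  constructor
  rw [← terminal.comp_from (BaseChange.str s K)]
  infer_instance

/-- Both coefficients are `-min ord(fᵢ) + ord(f_λ)`, and corresponding points have the same local
ring, hence the same orders. -/
theorem divisorTransform_member_apply (hL : L.NoFixedComponents) (v : L.Points K)
    {x : PrimeDivisor (BaseChange sX K)} {y : PrimeDivisor (BaseChange sY K)}
    (hxy : Corresponds (BaseChange.map K a rfl) (BaseChange.map K b h) x.1 y.1) :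
    divisorTransform (BaseChange.map K a rfl) (BaseChange.map K b h) (L.member v) y =
      (L.transform a b h).member v y := by
  rw [divisorTransform_apply _ _ _ hxy, L.member_apply hL.divisor_apply]
  refine .trans ?_ ((L.transform a b h).member_apply (fun _ => rfl) v y).symm
  have h1 : (fun i => functionFieldMap (BaseChange.proj sY K) ((L.transform a b h).basis i)) =
      fun i => birationalEquiv (BaseChange.map K a rfl) (BaseChange.map K b h)
        (functionFieldMap (BaseChange.proj sX K) (L.basis i)) :=
    funext fun i => (birationalEquiv_functionFieldMap_proj a b rfl h K (L.basis i)).symm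
  have h2 : BaseChange.map K a rfl ≫ BaseChange.str sX K =
      BaseChange.map K b h ≫ BaseChange.str sY K :=
    (BaseChange.map_str K a rfl).trans (BaseChange.map_str K b h).symm
  rw [h1]
  refine congr_arg₂ (fun m n : ℤ => -m + n) (minOrd_birationalEquiv _ _ x.2 y.2 hxy _).symm ?_
  refine .trans ?_ (congr_arg (fun f => (BaseChange sY K).ord f y.1)
    (birationalEquiv_linComb _ _ h2 _ v.rep))
  exact (ord_eq_ord_of_range_eq (birationalEquiv _ _) x.2 y.2 hxy _).symm

end Transform

/-! ### Minimal vanishing of a general member along a prime divisor. -/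

section Generic

theorem mem_range_of_ord_nonneg [IsLocallyNoetherian X] [IsNormalScheme X] {x : X}
    (hx : coheight x = 1) {f : X.functionField} (hf : 0 ≤ X.ord f x) :
    f ∈ (algebraMap (X.presheaf.stalk x) X.functionField).range := by
  by_cases hf0 : f = 0
  · rw [hf0]; exact zero_mem _
  have := isDiscreteValuationRing_stalk hx
  obtain ⟨a, b, ha, hb, rfl⟩ := exists_div_of_ne_zero x hf0
  have hinj := IsFractionRing.injective (X.presheaf.stalk x) X.functionField
  have hb' : algebraMap _ X.functionField b ≠ 0 := (map_ne_zero_iff _ hinj).mpr hb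
  rcases ValuationRing.dvd_total a b with ⟨c, rfl⟩ | ⟨c, rfl⟩
  · have ha' : algebraMap _ X.functionField a ≠ 0 := (map_ne_zero_iff _ hinj).mpr ha
    have hc : IsUnit c := by
      by_contra hc
      have h1 := ord_algebraMap_pos hx (right_ne_zero_of_mul hb) hc
      rw [map_mul, div_mul_cancel_left₀ ha', ord_inv] at hf
      linarith
    refine ⟨hc.unit⁻¹.1, ?_⟩
    rw [map_mul, div_mul_cancel_left₀ ha']
    refine eq_inv_of_mul_eq_one_left ?_
    rw [← map_mul, hc.val_inv_mul, map_one]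
  · exact ⟨c, by rw [map_mul, mul_div_cancel_left₀ _ hb']⟩

/-- A general member of a linear system vanishes to minimal order along a given prime divisor. -/
theorem exists_linComb_ord_eq_minOrd [IsLocallyNoetherian X] [IsNormalScheme X]
    (s : X ⟶ Spec (.of k)) (K : Type u) [Field K] [Algebra k K] [Algebra.IsAlgebraic k K]
    [IsIntegral (BaseChange s K)] [IsLocallyNoetherian (BaseChange s K)] {n : ℕ}
    {f : Fin (n + 1) → X.functionField} (hf : ∀ i, f i ≠ 0) {z : BaseChange s K}
    (hz : coheight z = 1) : ∃ c : Fin (n + 1) → K, c ≠ 0 ∧ ∀ v : Fin (n + 1) → K,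
      ∑ i, c i * v i ≠ 0 → (BaseChange s K).ord (linComb (BaseChange.str s K)
        (fun i => functionFieldMap (BaseChange.proj s K) (f i)) v) z =
          minOrd (fun i => functionFieldMap (BaseChange.proj s K) (f i)) z := by
  have hx : coheight (BaseChange.proj s K z) = 1 := by rw [BaseChange.coheight_proj, hz]
  -- The minimum is taken on the normal `X`, where order `≥ 0` means regular, so each `fᵢ / f_j` is
  -- a local section `α i` that can be pulled back to the possibly non-normal `X_K`.
  obtain ⟨j, -, hj⟩ := Finset.exists_mem_eq_inf' (Finset.univ_nonempty (α := Fin (n + 1)))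
    fun i => X.ord (f i) (BaseChange.proj s K z)
  have hmin : minOrd (fun i => functionFieldMap (BaseChange.proj s K) (f i)) z =
      (BaseChange s K).ord (functionFieldMap (BaseChange.proj s K) (f j)) z := by
    rw [minOrd_functionFieldMap _ hz hx hf, ord_functionFieldMap _ hz hx (hf j), minOrd, hj]
  have hu (i) : ∃ a : X.presheaf.stalk (BaseChange.proj s K z),
      algebraMap _ X.functionField a = f i / f j := by
    refine mem_range_of_ord_nonneg hx ?_
    rw [ord_div (hf i) (hf j), ← hj, sub_nonneg]
    exact Finset.inf'_le _ (Finset.mem_univ i)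
  choose α hα using hu
  let β (i) : (BaseChange s K).presheaf.stalk z := (BaseChange.proj s K).stalkMap z (α i)
  have hβ (i) : algebraMap _ (BaseChange s K).functionField (β i) *
      functionFieldMap (BaseChange.proj s K) (f j) =
        functionFieldMap (BaseChange.proj s K) (f i) := by
    rw [← functionFieldMap_algebraMap, ← map_mul, hα, div_mul_cancel₀ _ (hf j)]
  let γ : K →+* (BaseChange s K).presheaf.stalk z := ((BaseChange s K).presheaf.germ ⊤ z
    trivial).hom.comp ((Scheme.ΓSpecIso (.of K)).inv ≫ (BaseChange.str s K).appTop).hom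
  have hγ (c : K) : algebraMap _ (BaseChange s K).functionField (γ c) =
      constants (BaseChange.str s K) c := by
    have : Nonempty (⊤ : (BaseChange s K).Opens) := ⟨⟨z, trivial⟩⟩
    exact Scheme.algebraMap_germ_eq_germToFunctionField _ (U := ⊤) (x := z) trivial _
  let κ := IsLocalRing.ResidueField ((BaseChange s K).presheaf.stalk z)
  let := ((IsLocalRing.residue ((BaseChange s K).presheaf.stalk z)).comp γ).toAlgebra
  have hβj : β j = 1 := by
    apply IsFractionRing.injective _ (BaseChange s K).functionField
    have h1 := hβ j
    rw [mul_eq_right₀ (functionFieldMap_ne_zero _ (hf j))] at h1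
    rw [h1, map_one]
  -- Minimal order means that `∑ vᵢ βᵢ` has nonzero residue, a `κ`-valued linear condition on `v`. A
  -- `K`-linear functional with `φ 1 = 1` replaces it by a sufficient `K`-valued one, nontrivial
  -- since `β j = 1`.
  obtain ⟨φ, hφ⟩ := Module.Projective.exists_dual_eq_one K (one_ne_zero (α := κ))
  refine ⟨fun i => φ (IsLocalRing.residue _ (β i)), fun h => ?_, fun v hv => ?_⟩
  · have := congr_fun h j
    simp only [hβj, map_one, hφ] at this
    exact one_ne_zero this
  have hunit : IsUnit (∑ i, γ (v i) * β i) := by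
    rw [← IsLocalRing.residue_ne_zero_iff_isUnit]
    intro h
    apply hv
    have h1 := congr_arg φ h
    rw [map_sum, map_sum, map_zero] at h1
    rw [← h1]
    refine Finset.sum_congr rfl fun i _ => ?_
    rw [map_mul, mul_comm]
    exact (φ.map_smul (v i) (IsLocalRing.residue _ (β i))).symm
  have hlin : linComb (BaseChange.str s K)
      (fun i => functionFieldMap (BaseChange.proj s K) (f i)) v =
        algebraMap _ (BaseChange s K).functionField (∑ i, γ (v i) * β i) *
          functionFieldMap (BaseChange.proj s K) (f j) := by
    rw [linComb, map_sum, Finset.sum_mul]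
    refine Finset.sum_congr rfl fun i _ => ?_
    rw [map_mul, hγ, mul_assoc, hβ]
  rw [hlin, Scheme.ord_mul, ord_algebraMap_of_isUnit hz hunit, hmin, zero_add]
  · exact (map_ne_zero_iff _ (IsFractionRing.injective _ _)).mpr hunit.ne_zero
  · exact functionFieldMap_ne_zero _ (hf j)

end Generic

end

end WeilLinearSystem

/-! ### Exceptional prime divisors and the span of the members. -/

namespace WeilLinearSystem

section PrimeDivisors

variable {U X Y : Scheme.{u}} [IsIntegral U] [IsIntegral X] [IsIntegral Y]
  [AlgebraicGeometry.IsNoetherian Y] (a : U ⟶ X) (b : U ⟶ Y) [IsOpenImmersion a]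
  [IsOpenImmersion b]

/-- All but finitely many prime divisors of `Y` are birational transforms of prime divisors
of `X`. -/
theorem finite_not_corresponds :
    {y : PrimeDivisor Y | ∀ x : PrimeDivisor X, ¬ Corresponds a b x.1 y.1}.Finite := by
  have hη : genericPoint Y ∈ Set.range b :=
    have := isDominant_of_isOpenImmersion b
    ⟨genericPoint U, map_genericPoint b⟩
  refine (finite_primeDivisor_of_isClosed (C := (Set.range b)ᶜ)
    b.isOpenEmbedding.isOpen_range.isClosed_compl (fun h => h hη)).subset fun y hy hyb => ?_
  obtain ⟨x, hx⟩ := exists_corresponds a b y.2 hyb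
  exact hy x hx

end PrimeDivisors

section Principal

variable {X : Scheme.{u}} [IsIntegral X] [AlgebraicGeometry.IsNoetherian X]

theorem principal_mul {f g : X.functionField} (hf : f ≠ 0) (hg : g ≠ 0) :
    principal (f * g) = principal f + principal g :=
  Finsupp.ext fun _ => Scheme.ord_mul hf hg

theorem principal_div {f g : X.functionField} (hf : f ≠ 0) (hg : g ≠ 0) :
    principal (f / g) = principal f - principal g :=
  Finsupp.ext fun _ => ord_div hf hg _

theorem principal_constants {k : Type u} [Field k] (s : X ⟶ Spec (.of k)) {c : k} (hc : c ≠ 0) :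
    principal (constants s c) = 0 :=
  Finsupp.ext fun _ => ord_constants s hc _

end Principal

section Span

variable {k : Type u} [Field k] {X : Scheme.{u}} [IsIntegral X] [AlgebraicGeometry.IsNoetherian X]
  {s : X ⟶ Spec (.of k)} [GeometricallyIntegral s] (L : LinearSystem s) {K : Type u} [Field K]
  [Algebra k K]

/-- The pull-back to `X_K` of the rational function `∑ cᵢ fᵢ`, for `c ∈ K^{n+1}`. -/
noncomputable abbrev LinearSystem.fn (c : Fin (L.dim + 1) → K) : (BaseChange s K).functionField :=
  linComb (BaseChange.str s K) (fun i => functionFieldMap (BaseChange.proj s K) (L.basis i)) c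

theorem LinearSystem.fn_ne_zero {c : Fin (L.dim + 1) → K} (hc : c ≠ 0) : L.fn c ≠ 0 :=
  fun h => hc (eq_zero_of_linComb_eq_zero s K L.linearIndependent h)

theorem LinearSystem.fn_smul (a : K) (c : Fin (L.dim + 1) → K) :
    L.fn (a • c) = constants (BaseChange.str s K) a * L.fn c := by
  simp only [fn, linComb, Finset.mul_sum, Pi.smul_apply, smul_eq_mul, map_mul, mul_assoc]

theorem LinearSystem.fn_add (c d : Fin (L.dim + 1) → K) : L.fn (c + d) = L.fn c + L.fn d := by
  simp only [fn, linComb, Pi.add_apply, map_add, add_mul, Finset.sum_add_distrib]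

variable [IsProper s]

theorem LinearSystem.member_eq_add (v w : L.Points K) :
    L.member w = L.member v + principal (L.fn w.rep / L.fn v.rep) := by
  rw [principal_div (L.fn_ne_zero w.rep_nonzero) (L.fn_ne_zero v.rep_nonzero)]
  change pullbackDivisor _ _ + principal (L.fn w.rep) =
    pullbackDivisor _ _ + principal (L.fn v.rep) + _
  abel

/-- Independence of the representative: nonzero constants have trivial divisor. -/
theorem LinearSystem.member_mk {c : Fin (L.dim + 1) → K} (hc : c ≠ 0) :
    L.member (Projectivization.mk K c hc) =
      pullbackDivisor (BaseChange.proj s K) L.divisor + principal (L.fn c) := by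
  obtain ⟨a, ha⟩ := Projectivization.exists_smul_eq_mk_rep K c hc
  change _ + principal (L.fn _) = _
  rw [← ha, Units.smul_def, L.fn_smul, principal_mul (constants_ne_zero _ a.ne_zero)
    (L.fn_ne_zero hc), principal_constants _ a.ne_zero, zero_add]

/-- The members of a linear system form the linear system spanned by the members parametrized
by a set which is not contained in a hyperplane. -/
theorem LinearSystem.members_eq_spannedSystem [IsNormalScheme X] [IsAlgClosure k K]
    {W : Set (L.Points K)} (hW : Submodule.span K (Projectivization.rep '' W) = ⊤) :
    L.members K = spannedSystem (BaseChange.str s K) ((fun v => L.member v) '' W) := by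
  let := (constants (BaseChange.str s K)).toAlgebra
  have hdiv (v : L.Points K) (c : Fin (L.dim + 1) → K) :
      L.fn c / L.fn v.rep * L.fn v.rep = L.fn c :=
    div_mul_cancel₀ _ (L.fn_ne_zero v.rep_nonzero)
  -- Dividing by `f_v` makes `D_v` the base divisor: `D_w = D_v + (φ v w)`.
  let φ (v : L.Points K) : (Fin (L.dim + 1) → K) →ₗ[K] (BaseChange s K).functionField :=
    { toFun c := L.fn c / L.fn v.rep
      map_add' c d := by rw [L.fn_add, add_div]
      map_smul' a c := by rw [L.fn_smul, mul_div_assoc, Algebra.smul_def]; rfl }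
  apply Set.Subset.antisymm
  · rintro _ ⟨w, rfl⟩
    obtain ⟨v, hv⟩ : W.Nonempty := by
      rw [Set.nonempty_iff_ne_empty]
      rintro rfl
      rw [Set.image_empty, Submodule.span_empty] at hW
      exact bot_ne_top hW
    refine ⟨L.member v, ⟨v, hv, rfl⟩, φ v w.rep, ?_, ?_, L.member_eq_add v w⟩
    · have h1 : w.rep ∈ Submodule.span K (Projectivization.rep '' W) := hW ▸ trivial
      have h2 := Submodule.mem_map_of_mem (f := φ v) h1
      rw [Submodule.map_span] at h2
      refine Submodule.span_mono ?_ h2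
      rintro _ ⟨_, ⟨x, hx, rfl⟩, rfl⟩
      exact ⟨div_ne_zero (L.fn_ne_zero x.rep_nonzero) (L.fn_ne_zero v.rep_nonzero),
        x, hx, L.member_eq_add v x⟩
    · exact div_ne_zero (L.fn_ne_zero w.rep_nonzero) (L.fn_ne_zero v.rep_nonzero)
  · rintro _ ⟨_, ⟨v, hv, rfl⟩, f, hf, hf0, rfl⟩
    have hfφ : f ∈ LinearMap.range (φ v) := by
      refine Submodule.span_le.mpr ?_ hf
      rintro h ⟨hh0, x, hx, hxh⟩
      have hq := div_ne_zero (L.fn_ne_zero x.rep_nonzero) (L.fn_ne_zero v.rep_nonzero)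
      have h1 : principal h = principal (L.fn x.rep / L.fn v.rep) :=
        add_left_cancel (hxh.symm.trans (L.member_eq_add v x))
      -- The span in `spannedSystem` runs over all `h` with the right divisor. Such an `h` differs
      -- from `f_x / f_v` by a function with zero divisor, that is, by a constant, so it lies in the
      -- range of `φ v`.
      obtain ⟨c, hc⟩ := mem_range_constants_of_ord_eq_zero s K (div_ne_zero hh0 hq)
        fun z hz => by
          rw [ord_div hh0 hq, sub_eq_zero]
          exact congr($h1 ⟨z, hz⟩)
      refine ⟨c • x.rep, ?_⟩
      rw [map_smul, Algebra.smul_def]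
      exact (congr_arg (· * _) hc).trans (div_mul_cancel₀ _ hq)
    obtain ⟨c, rfl⟩ := hfφ
    have hc : c ≠ 0 := fun h => hf0 (by rw [h, map_zero])
    refine ⟨Projectivization.mk K c hc, ?_⟩
    change L.member (Projectivization.mk K c hc) = L.member v + principal (L.fn c / L.fn v.rep)
    rw [L.member_mk, principal_div (L.fn_ne_zero hc) (L.fn_ne_zero v.rep_nonzero)]
    change _ = pullbackDivisor _ _ + principal (L.fn v.rep) + _
    abel

end Span

end WeilLinearSystem

/-! ### The theorem. -/

theorem mainTheorem9 {k : Type u} [Field k] {K : Type u} [Field K] [Algebra k K]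
    [IsAlgClosure k K] {X Y : Scheme.{u}}
    [IsIntegral X] [AlgebraicGeometry.IsNoetherian X] [IsNormalScheme X]
    [IsIntegral Y] [AlgebraicGeometry.IsNoetherian Y] [IsNormalScheme Y]
    (sX : X ⟶ Spec (.of k)) (sY : Y ⟶ Spec (.of k))
    [IsProper sX] [GeometricallyIntegral sX] [IsProper sY] [GeometricallyIntegral sY]
    (g : X.PartialIso Y) (hg : g.IsOver sX sY)
    (L : LinearSystem sX) (hL : L.NoFixedComponents)
    (W : Set (L.Points K)) (hW : IsGeomIrreducibleSubvariety k W)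
    (hspan : Projectivization.Subspace.span W = ⊤) :
    ∃ W₀ : Set (L.Points K), IsDenseOpenIn k W₀ W ∧
      (∀ v ∈ W₀, ∀ w ∈ W₀, LinearlyEquivalent
        (birTransformDivisor g hg (L.member v)) (birTransformDivisor g hg (L.member w))) ∧
      (L.birTransform g hg).members K =
        spannedSystem (BaseChange.str sY K)
          ((fun v => birTransformDivisor g hg (L.member v)) '' W₀) := by
  classical
  have := IsAlgClosure.isAlgebraic (R := k) (K := K)
  have : IsIntegral g.source.toScheme := isIntegral_of_isOpenImmersion g.source.ι
  let a := BaseChange.map K (sX := sX) g.source.ι rfl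
  let b := BaseChange.map K (g.iso.hom ≫ g.target.ι) (isOver_comp hg)
  have hfin := finite_not_corresponds a b
  -- A hyperplane is chosen for every `y`, but only the finitely many with `y` not coming from `X_K`
  -- are removed from `W`.
  choose c hc0 hc using fun y : PrimeDivisor (BaseChange sY K) =>
    exists_linComb_ord_eq_minOrd sY K (L.birTransform g hg).basis_ne_zero y.2
  obtain ⟨W₀, hW₀, hW₀c, hW₀s⟩ := exists_isDenseOpenIn hW hspan (hfin.toFinset.image c) (by
    intro d hd
    obtain ⟨y, -, rfl⟩ := Finset.mem_image.mp hd
    exact hc0 y)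
  have key : ∀ v ∈ W₀, birTransformDivisor g hg (L.member v) =
      (L.birTransform g hg).member (K := K) v := by
    intro v hv
    ext y
    by_cases hy : ∃ x : PrimeDivisor (BaseChange sX K), Corresponds a b x.1 y.1
    · obtain ⟨x, hx⟩ := hy
      exact divisorTransform_member_apply _ _ (isOver_comp hg) hL v hx
    · rw [not_exists] at hy
      refine (divisorTransform_apply_eq_zero a b _ hy).trans ?_
      -- Off the hyperplane of `y` the order of `f_v` is minimal, so `y` is not a component of the
      -- member of `g_*|D|`, in agreement with the coefficient `0` of the transform.
      refine .trans (neg_add_eq_zero.mpr (hc y v.rep ?_).symm).symm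
        ((L.birTransform g hg).member_apply (fun _ => rfl) v y).symm
      exact hW₀c v hv (c y) (Finset.mem_image_of_mem c (hfin.mem_toFinset.mpr hy))
  refine ⟨W₀, hW₀, fun v hv w hw => ?_, ?_⟩
  · rw [key v hv, key w hw]
    exact ⟨_, div_ne_zero ((L.birTransform g hg).fn_ne_zero w.rep_nonzero)
      ((L.birTransform g hg).fn_ne_zero v.rep_nonzero), (L.birTransform g hg).member_eq_add v w⟩
  · rw [Set.image_congr key]
    exact (L.birTransform g hg).members_eq_spannedSystem hW₀s
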